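/- **Setting.** Let $X$ be a compact subset of $\mathbb R^n$ (or of any Polish space $E$; interiors and boundaries below are taken in $E$, so that for instance $E=\mathbb R^n$ and $E=X$ are both allowed). Let $\mu$ be a Borel probability measure on $X$ with $\mu(\{x\})=0$ for every $x$, and let $\mathcal B$ be the completion of the Borel $\sigma$-algebra with respect to $\mu$. Let $\mathcal Z=\{Z_1,\dots,Z_N\}$ be closed subsets of $X$ with $\mu(Z_j)>0$, $\mu(Z_i\cap Z_j)=0$ for $i\ne j$ and $\mu(\bigcup_j Z_j)=1$. Let $T:X\to X$ satisfy: (c1) for each $j$, the restriction of $T$ to $\operatorname{int}Z_j$ extends uniquely to a continuous injective map $Z_j\to\overline{T(\operatorname{int}Z_j)}$; (c2) for $A\in\mathcal B$ also $TA,\,T^{-1}A\in\mathcal B$, and $\mu(A)=0$ implies $\mu(T^{-1}A)=0$; (c3) the cylinder sets $Z_{j_0\cdots j_n}=Z_{j_0}\cap T^{-1}Z_{j_1}\cap\dots\cap T^{-n}Z_{j_n}$ of positive measure generate $\mathcal B$ up to $\mu$-null sets; (c4) there are constants $s_j\ge 1$ with $\mu(TA)=s_j\mu(A)$ for all measurable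 $A\subseteq Z_j$; (c5) if $A\in\mathcal B$ and $T^{-1}A=A$, then $\mu(A)\in\{0,1\}$; (c6) $\mu\big(\bigcup_{n\ge0}T^n(\bigcup_j\partial Z_j)\big)=0$. **Hofbauer tower.** Let $\{D_u:u\in\alpha\}$, $\alpha\subseteq\mathbb N$, enumerate without repetition the sets $T^nZ_{j_0\cdots j_n}$, $n\ge0$, $\mu(Z_{j_0\cdots j_n})>0$, where sets that differ by a $\mu$-null set are identified; each $D_u$ is represented by a subset of the corresponding $Z_{j_n}$, and the first $N$ of the $D_u$ are $Z_1,\dots,Z_N$. Write $D_u\to D_v$ if $D_v=Z_j\cap TD_u$ (mod $\mu$) for some $j$ with $\mu(Z_j\cap TD_u)>0$. Let $\hat X=\bigsqcup_uD_u$ and, for almost every point, let $\hat T(x,D_u)=(Tx,D_v)$, where $D_u\to D_v$ and $Tx\in D_v$. Let $\bar\mu$ be the measure on $\hat X$ that is the copy of $\mu$ on each $D_u$, let $\hat X_0$ be the union of the first $N$ levels, and let $\hat\mu_n(A)=\frac1n\sum_{k=0}^{n-1}\bar\mu(\hat T^{-k}A\cap\hat X_0)$. Assume that $\mu$ lifts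 to a probability measure $\hat\mu$, that is, $\hat\mu_n$ converges vaguely (weakly on each level) to a probability measure $\hat\mu$ on $\hat X$. **Natural extension.** Put $\rho(D_u)=\hat\mu(D_u)/\bar\mu(D_u)$, $R_u=D_u\times[0,\rho(D_u)]$ (the rug of $D_u$) and $Y=\bigsqcup_uR_u$, let $\mathcal C$ be the Borel $\sigma$-algebra on $Y$ and let $\nu$ be the restriction to $Y$ of $\bar\mu\times$ Lebesgue measure. For $(\hat x,y)\in R_u$ with $D_u\subseteq Z_j$ and $\hat T\hat x\in D_v$ let $$F(\hat x,y)=\Big(\hat T\hat x,\ \frac y{s_j}+\sum_{k=1}^N\ \sum_{t<u,\ Z_k\supseteq D_t\to D_v}\frac{\rho(D_t)}{s_k}\Big).$$ **Statement.** The measure $\nu$ is a probability measure, and $\nu$-almost every $z\in Y$ has exactly one two-sided $F$-orbit $(F^kz)_{k\in\mathbb Z}$ in $Y$. For such $z$ let $\psi(z)=(b_k)_{k\in\mathbb Z}\in\alpha^{\mathbb Z}$, where $F^kz\in R_{b_k}$. Let $v_u=\hat\mu(D_u)$ and $p_{t,u}=\bar\mu(D_t\cap\hat T^{-1}D_u)/\bar\mu(D_t)$.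 Then $v$ is a probability vector, $P=(p_{t,u})$ is a stochastic matrix and $vP=v$, so that there is a unique two-sided Markov measure $m_v$ on $\alpha^{\mathbb Z}$ with initial vector $v$ and transition matrix $P$. With $\Omega=\psi(Y)$, $\mathcal P$ the product $\sigma$-algebra and $\sigma$ the left shift, $\psi$ is an isomorphism from $(Y,\mathcal C,\nu,F)$ to $(\Omega,\mathcal P,m_v,\sigma)$: there are measurable sets $Y^*\subseteq Y$ and $\Omega^*\subseteq\Omega$ with $\nu(Y^*)=1=m_v(\Omega^*)$, $F(Y^*)\subseteq Y^*$ and $\sigma(\Omega^*)\subseteq\Omega^*$, such that $\psi:Y^*\to\Omega^*$ is a bi-measurable bijection with $m_v=\nu\circ\psi^{-1}$ and $\psi\circ F=\sigma\circ\psi$ on $Y^*$. -/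

import Mathlib

open MeasureTheory Set Filter Topology
open scoped ENNReal BoundedContinuousFunction

noncomputable section

/-- Data of a piecewise injective system: the compact space `X`, sitting in an ambient Polish space
`E`, the measure `μ`, the finite collection `Z` of pieces, the map `T` (only its values on `X`
matter) and the Jacobians `s`. Interiors and boundaries of the pieces are taken in `E`. Thus
`E = ℝⁿ` gives the usual interior and boundary in `ℝⁿ`, while taking for `E` the compact set itself,
as a space of its own, gives the relative ones. -/
structure PWSystem (E : Type*) [TopologicalSpace E] [MeasurableSpace E] where
  X : Set E
  μ : Measure E
  N : ℕ
  Z : Fin N → Set E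
  T : E → E
  s : Fin N → ℝ

namespace PWSystem

section System

variable {E : Type*} [TopologicalSpace E] [MeasurableSpace E] (S : PWSystem E)

/-- The sets of the `σ`-algebra on `X`: the Borel sets, completed with respect to `μ`. -/
def InB (A : Set E) : Prop := A ⊆ S.X ∧ NullMeasurableSet A S.μ

/-- The cylinder set `Z_{w 0} ∩ T⁻¹ Z_{w 1} ∩ ⋯ ∩ T⁻ⁿ Z_{w n}`. -/
def cyl {n : ℕ} (w : Fin (n + 1) → Fin S.N) : Set E :=
  {x | x ∈ S.X ∧ ∀ k : Fin (n + 1), S.T^[(k : ℕ)] x ∈ S.Z (w k)}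

/-- The image `Tⁿ Z_{w 0 ⋯ w n}` of an `(n+1)`-cylinder. -/
def img {n : ℕ} (w : Fin (n + 1) → Fin S.N) : Set E := S.T^[n] '' S.cyl w

/-- All cylinder sets (those of positive measure), of all lengths. -/
def cylinders : Set (Set E) :=
  {A | ∃ (n : ℕ) (w : Fin (n + 1) → Fin S.N), 0 < S.μ (S.cyl w) ∧ A = S.cyl w}

/-- The standing assumptions: `X` is compact, `μ` is a probability measure on `X`, the closed sets
`Z j` partition `X` up to null sets, and the conditions (c1)-(c6) hold. -/
structure Conditions : Prop where
  isCompact : IsCompact S.X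
  isProbability : IsProbabilityMeasure S.μ
  carrier : S.μ S.Xᶜ = 0
  mapsTo : MapsTo S.T S.X S.X
  closed : ∀ j, IsClosed (S.Z j)
  subset : ∀ j, S.Z j ⊆ S.X
  pos : ∀ j, 0 < S.μ (S.Z j)
  disj : ∀ i j, i ≠ j → S.μ (S.Z i ∩ S.Z j) = 0
  cover : S.μ (⋃ j, S.Z j) = 1
  /-- `T` on `int Z` extends uniquely to a continuous injective map from `Z` to the closure of
  `T (int Z)`. -/
  c1 : ∀ j, ∃! g : S.Z j → closure (S.T '' interior (S.Z j)),
    Continuous g ∧ Function.Injective g ∧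
      ∀ x : S.Z j, (x : E) ∈ interior (S.Z j) → (g x : E) = S.T x
  /-- `T` maps measurable sets to measurable sets, is measurable, and is non-singular. -/
  c2 : ∀ A, S.InB A → S.InB (S.T '' A) ∧ S.InB (S.X ∩ S.T ⁻¹' A) ∧
    (S.μ A = 0 → S.μ (S.X ∩ S.T ⁻¹' A) = 0)
  /-- The cylinder sets generate the `σ`-algebra, up to null sets. -/
  c3 : ∀ A, S.InB A → ∃ A', MeasurableSet[MeasurableSpace.generateFrom S.cylinders] A' ∧
    A' =ᵐ[S.μ] A
  /-- The Jacobian of `T` is constant, equal to `s j ≥ 1`, on each piece. -/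
  c4 : ∀ j, 1 ≤ S.s j ∧
    ∀ A, S.InB A → A ⊆ S.Z j → S.μ (S.T '' A) = ENNReal.ofReal (S.s j) * S.μ A
  /-- `μ` is ergodic (but not necessarily invariant). -/
  c5 : ∀ A, S.InB A → S.X ∩ S.T ⁻¹' A = A → S.μ A = 0 ∨ S.μ A = 1
  /-- The forward orbit of the boundaries of the pieces is a null set. -/
  c6 : S.μ (⋃ n : ℕ, S.T^[n] '' ⋃ j, frontier (S.Z j)) = 0

/-- An enumeration of the levels of the Hofbauer tower: `D u`, `u ∈ α ⊆ ℕ`, lists without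
repetition the classes modulo null sets of the sets `Tⁿ Z_{w 0 ⋯ w n}`, each class being represented
by a set `D u` inside the piece `Z_{w n}`; the first `N` levels are the pieces themselves. -/
structure Tower where
  α : Set ℕ
  D : α → Set E
  /-- the index of the piece that contains `D u` -/
  last : α → Fin S.N
  D_subset : ∀ u, D u ⊆ S.Z (last u)
  exists_word : ∀ u, ∃ (n : ℕ) (w : Fin (n + 1) → Fin S.N),
    0 < S.μ (S.cyl w) ∧ w (Fin.last n) = last u ∧ D u =ᵐ[S.μ] S.img w
  exists_level : ∀ (n : ℕ) (w : Fin (n + 1) → Fin S.N),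
    0 < S.μ (S.cyl w) → ∃ u, D u =ᵐ[S.μ] S.img w
  inj : ∀ u v, D u =ᵐ[S.μ] D v → u = v
  base_mem : ∀ j : Fin S.N, (j : ℕ) ∈ α
  base_eq : ∀ j : Fin S.N, D ⟨j, base_mem j⟩ = S.Z j

end System

namespace Tower

variable {E : Type*} [TopologicalSpace E] [MeasurableSpace E] {S : PWSystem E} (τ : Tower S)

/-- The arrow `D u → D v`: `D v` is (the class of) `Z j ∩ T (D u)` for some `j` for which the latter
has positive measure. -/
def Arrow (u v : τ.α) : Prop :=
  ∃ j, 0 < S.μ (S.Z j ∩ S.T '' τ.D u) ∧ τ.D v =ᵐ[S.μ] (S.Z j ∩ S.T '' τ.D u : Set E)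

/-- The level `D u` as a subset of the tower; a point of the tower is a pair `(x, u)`, `x ∈ D u`. -/
def level (u : τ.α) : Set (E × τ.α) := {p | p.2 = u ∧ p.1 ∈ τ.D u}

/-- The base of the tower, formed by the first `N` levels. -/
def base : Set (E × τ.α) := {p | (p.2 : ℕ) < S.N ∧ p.1 ∈ τ.D p.2}

open Classical in
/-- The tower map `(x, D u) ↦ (T x, Z j ∩ T (D u))` for `T x ∈ Z j`. Where no target level is
available, which happens on a null set only, it is set to be the identity. -/
def That (p : E × τ.α) : E × τ.α :=
  if h : ∃ v, τ.Arrow p.2 v ∧ S.T p.1 ∈ τ.D v then (S.T p.1, h.choose) else p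

/-- The measure on the tower that is a copy of `μ` on each level. -/
def mubar : Measure (E × τ.α) :=
  Measure.sum fun u : τ.α => (S.μ.restrict (τ.D u)).map fun x => (x, u)

/-- The Cesàro means `A ↦ (1/n) ∑_{k < n} mubar (That⁻ᵏ A ∩ base)`. -/
def cesaro (n : ℕ) : Measure (E × τ.α) :=
  (n : ℝ≥0∞)⁻¹ • ∑ k ∈ Finset.range n, (τ.mubar.restrict τ.base).map (τ.That^[k])

/-- `μhat` is the vague limit of the Cesàro means: on each of the levels (of which a compact part of
the tower meets only finitely many) there is weak convergence. -/
def IsVagueLimit (μhat : Measure (E × τ.α)) : Prop :=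
  ∀ (u : τ.α) (f : E →ᵇ ℝ),
    Tendsto (fun n => ∫ p in {p : E × τ.α | p.2 = u}, f p.1 ∂(τ.cesaro n)) atTop
      (𝓝 (∫ p in {p : E × τ.α | p.2 = u}, f p.1 ∂μhat))

variable (μhat : Measure (E × τ.α))

/-- The density `μhat (D u) / mubar (D u)`. -/
def rho (u : τ.α) : ℝ := (μhat (τ.level u) / τ.mubar (τ.level u)).toReal

/-- The rug `R u = D u × [0, rho u]`. -/
def rug (u : τ.α) : Set ((E × τ.α) × ℝ) := τ.level u ×ˢ Icc 0 (τ.rho μhat u)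

/-- The domain `Y` of the natural extension, the disjoint union of the rugs. -/
def Y : Set ((E × τ.α) × ℝ) := ⋃ u, τ.rug μhat u

/-- The measure on `Y`: the product of `mubar` and Lebesgue measure. -/
def nu : Measure ((E × τ.α) × ℝ) := (τ.mubar.prod volume).restrict (τ.Y μhat)

open Classical in
/-- The height in the rug `R v` at which the image of `R u` starts. -/
def offset (u v : τ.α) : ℝ :=
  ∑ k : Fin S.N, ∑' t : τ.α,
    if t < u ∧ τ.D t ⊆ S.Z k ∧ τ.Arrow t v then τ.rho μhat t / S.s k else 0

/-- The natural extension map. -/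
def F (z : (E × τ.α) × ℝ) : (E × τ.α) × ℝ :=
  (τ.That z.1, z.2 / S.s (τ.last z.1.2) + τ.offset μhat z.1.2 (τ.That z.1).2)

/-- `o` is a two-sided `F`-orbit in `Y`. -/
def IsOrbit (o : ℤ → (E × τ.α) × ℝ) : Prop :=
  ∀ k, o k ∈ τ.Y μhat ∧ τ.F μhat (o k) = o (k + 1)

open Classical in
/-- The coding map: `psi z k = u` if `Fᵏ z ∈ R u`. (A constant sequence is assigned to the points
without two-sided orbit.) -/
def psi (z : (E × τ.α) × ℝ) : ℤ → τ.α :=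
  if h : ∃ o, τ.IsOrbit μhat o ∧ o 0 = z then fun k => (h.choose k).1.2 else fun _ => z.1.2

/-- The initial vector `v u = μhat (D u)`. -/
def initVec (u : τ.α) : ℝ≥0∞ := μhat (τ.level u)

/-- The transition probabilities `p t u = mubar (D t ∩ That⁻¹ (D u)) / mubar (D t)`. -/
def trans (t u : τ.α) : ℝ≥0∞ :=
  τ.mubar (τ.level t ∩ τ.That ⁻¹' τ.level u) / τ.mubar (τ.level t)

end Tower

end PWSystem

/-- The left shift on two-sided sequences. -/
def zshift {α : Type*} (b : ℤ → α) : ℤ → α := fun k => b (k + 1)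

/-- `m` is the two-sided Markov measure with initial vector `v` and transition matrix `P`: it is a
probability measure with
`m {b | b k = w 0, …, b (k+n) = w n} = v (w 0) * P (w 0) (w 1) * ⋯ * P (w (n-1)) (w n)`. -/
structure IsMarkovMeasure {α : Type*} [MeasurableSpace α] (v : α → ℝ≥0∞) (P : α → α → ℝ≥0∞)
    (m : Measure (ℤ → α)) : Prop where
  isProbability : IsProbabilityMeasure m
  cylinder : ∀ (k : ℤ) (n : ℕ) (w : ℕ → α),
    m {b | ∀ i ≤ n, b (k + i) = w i} = v (w 0) * ∏ i ∈ Finset.range n, P (w i) (w (i + 1))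

/-- `φ` is an isomorphism from the system `(A, μ, S)` to `(B, ν, R)`, where `A` and `B` are subsets of
measurable spaces: between invariant measurable sets of full measure, `φ` is a bijection that is
measurable in both directions, transports the measure and intertwines the dynamics. -/
def IsIsomorphism {α β : Type*} [MeasurableSpace α] [MeasurableSpace β]
    (A : Set α) (μ : Measure α) (S : α → α) (B : Set β) (ν : Measure β) (R : β → β)
    (φ : α → β) : Prop :=
  ∃ A' ⊆ A, ∃ B' ⊆ B, MeasurableSet A' ∧ MeasurableSet B' ∧ μ A' = 1 ∧ ν B' = 1 ∧
    MapsTo S A' A' ∧ MapsTo R B' B' ∧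
    BijOn φ A' B' ∧
    (∀ C ⊆ A', MeasurableSet C → MeasurableSet (φ '' C)) ∧
    (∀ C ⊆ B', MeasurableSet C → MeasurableSet (A' ∩ φ ⁻¹' C)) ∧
    (∀ C, MeasurableSet C → ν C = μ (A' ∩ φ ⁻¹' C)) ∧
    (∀ x ∈ A', φ (S x) = R (φ x))

end

set_option linter.unusedSectionVars false

noncomputable section

/-! Along an arrow `t → v` the tower map sends a part of `D t` injectively onto `D v`, up to null
sets, with constant Jacobian `s t`. Densities that are constant on levels therefore stay so under
push-forward, and invariance becomes a question about a transfer operator acting on functions of the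
level. A vague limit of the Cesàro means has such a density `ρ`. A Fatou argument gives `transfer ρ
≤ ρ`, and conservation of the finite total mass excludes strict inequality
(`transfer_eq_of_tendsto`, `exists_density`).

The resulting identity, that `ρ v` is the sum of `ρ t / s t` over the arrows `t → v`, says that the
images of the rugs, stretched by `s t` along the base and compressed by `s t` in height, tile the
rug over `v`. So `F` preserves `ν` (`measurePreserving_skew`) and is almost everywhere injective
(`injOn_skew`). Removing a null set closed under images and preimages leaves a core on which `F` is
a bijection (`exists_isInvariantCore`); the core also contains all preimages in `Y` of its points,
which makes two-sided orbits unique. Since branches are full and Jacobians constant, the measure of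
an itinerary is a product (`lintegral_itinerary`), and the code has a Markov distribution.

It remains to recover a point from its code. The forward code determines the base point, because
cylinders generate the σ-algebra. For two points with the same code the offsets cancel, so their
difference in height is divided by `s` at each step. By Poincaré recurrence of the inverse, some
level is visited infinitely often in the past. Each return closes a loop of arrows, and some
Jacobian along the loop is not `1`: otherwise a whole level would share one itinerary and reduce to
a point, which has no mass (`exists_s_ne_one`). As there are finitely many pieces, the Jacobians
other than `1` are bounded away from `1`. Followed backwards, a nonzero difference would outgrow the
height of the recurrent rug (`eq_zero_of_contracted`). Measurability of the inverse is
Lusin–Souslin.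

The levels are only null-measurable, and `T` is Borel only away from exceptional sets, so the
argument runs on an abstract `MarkovTower` built from Borel versions (`coreLevel`, `measurableMap`).
-/

/-- A countable Markov tower over a measurable map `T`: measurable levels `D u`, joined by arrows
`t → v` along which `T` maps a part of `D t` injectively onto `D v` (up to null sets), expanding the
measure by the constant factor `s t`. -/
structure MarkovTower (E ι : Type*) [MeasurableSpace E] where
  μ : Measure E
  finite : IsFiniteMeasure μ
  T : E → E
  measurable_T : Measurable T
  D : ι → Set E
  measurableSet_D : ∀ t, MeasurableSet (D t)
  s : ι → ℝ
  one_le_s : ∀ t, 1 ≤ s t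
  Arrow : ι → ι → Prop
  eq_of_arrow : ∀ {t v v' x}, Arrow t v → Arrow t v' → x ∈ D v → x ∈ D v' → v = v'
  exhaust : ∀ t, ∀ᵐ x ∂(μ.restrict (D t)), ∃ v, Arrow t v ∧ T x ∈ D v
  jacobian : ∀ {t v}, Arrow t v → ∀ B, MeasurableSet B → B ⊆ D v →
    ENNReal.ofReal (s t) * μ (D t ∩ T ⁻¹' B) = μ B
  injOn : ∀ t, InjOn T (D t)
  pos : ∀ t, 0 < μ (D t)

/-! ### Transfer operator, stationarity and itineraries in a Markov tower. -/

namespace MarkovTower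

variable {E ι : Type*} [MeasurableSpace E] [Countable ι] [MeasurableSpace ι]
  [DiscreteMeasurableSpace ι] (M : MarkovTower E ι)

attribute [instance] MarkovTower.finite

/-- The Jacobian as an extended nonnegative real. -/
def jac (t : ι) : ℝ≥0∞ := ENNReal.ofReal (M.s t)

lemma s_pos (t : ι) : 0 < M.s t := lt_of_lt_of_le one_pos (M.one_le_s t)

lemma jac_ne_zero (t : ι) : M.jac t ≠ 0 := by
  simpa [jac] using M.s_pos t

lemma jac_ne_top (t : ι) : M.jac t ≠ ∞ := ENNReal.ofReal_ne_top

open Classical in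
/-- The level above `T x`, for a point `x` of the level `t`. -/
def next (p : E × ι) : ι :=
  if h : ∃ v, M.Arrow p.2 v ∧ M.T p.1 ∈ M.D v then h.choose else p.2

/-- The tower map. -/
def step (p : E × ι) : E × ι := (M.T p.1, M.next p)

lemma next_eq {t v : ι} {x : E} (h : M.Arrow t v) (hx : M.T x ∈ M.D v) : M.next (x, t) = v := by
  have h' : ∃ v, M.Arrow t v ∧ M.T x ∈ M.D v := ⟨v, h, hx⟩
  have : M.next (x, t) = h'.choose := dif_pos h'
  rw [this]
  exact M.eq_of_arrow h'.choose_spec.1 h h'.choose_spec.2 hx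

lemma next_eq_iff {t v : ι} {x : E} : M.next (x, t) = v ↔
    (M.Arrow t v ∧ M.T x ∈ M.D v) ∨ ((¬ ∃ v, M.Arrow t v ∧ M.T x ∈ M.D v) ∧ t = v) := by
  by_cases h : ∃ v, M.Arrow t v ∧ M.T x ∈ M.D v
  · obtain ⟨w, hw⟩ := h
    rw [M.next_eq hw.1 hw.2]
    constructor
    · rintro rfl; exact Or.inl hw
    · rintro (h | h)
      · exact M.eq_of_arrow hw.1 h.1 hw.2 h.2
      · exact absurd ⟨w, hw⟩ h.1
  · have : M.next (x, t) = t := dif_neg h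
    rw [this]
    constructor
    · intro h'; exact Or.inr ⟨h, h'⟩
    · rintro (h' | h')
      · exact absurd ⟨v, h'⟩ h
      · exact h'.2

lemma measurable_next : Measurable M.next := by
  refine measurable_from_prod_countable_left fun t => measurable_to_countable' fun v => ?_
  have : (fun x => M.next (x, t)) ⁻¹' {v} = {x | (M.Arrow t v ∧ M.T x ∈ M.D v) ∨
      ((¬ ∃ v, M.Arrow t v ∧ M.T x ∈ M.D v) ∧ t = v)} := by
    ext x; exact M.next_eq_iff
  rw [this]
  have hm : ∀ v, MeasurableSet {x | M.Arrow t v ∧ M.T x ∈ M.D v} := fun v =>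
    (MeasurableSet.const _).inter (M.measurable_T (M.measurableSet_D v))
  have he : MeasurableSet {x | ∃ v, M.Arrow t v ∧ M.T x ∈ M.D v} := by
    rw [ofPred_exists]; exact MeasurableSet.iUnion hm
  exact (hm v).union (he.compl.inter (MeasurableSet.const _))

lemma measurable_step : Measurable M.step :=
  (M.measurable_T.comp measurable_fst).prodMk M.measurable_next

lemma map_T_restrict {t v : ι} (h : M.Arrow t v) :
    (M.μ.restrict (M.D t ∩ M.T ⁻¹' M.D v)).map M.T = (M.jac t)⁻¹ • M.μ.restrict (M.D v) := by
  ext B hB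
  rw [Measure.map_apply M.measurable_T hB, Measure.restrict_apply (M.measurable_T hB),
    Measure.smul_apply, Measure.restrict_apply hB, smul_eq_mul,
    ← M.jacobian h _ (hB.inter (M.measurableSet_D v)) inter_subset_right, ← mul_assoc]
  change _ = (M.jac t)⁻¹ * M.jac t * _
  rw [ENNReal.inv_mul_cancel (M.jac_ne_zero t) (M.jac_ne_top t), one_mul]
  congr 1; ext x; simp; tauto

open Classical in
/-- The transfer formula for the tower map. -/
lemma lintegral_step (t : ι) {h : E × ι → ℝ≥0∞} (hh : Measurable h) :
    ∫⁻ x in M.D t, h (M.step (x, t)) ∂M.μ =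
      ∑' v, if M.Arrow t v then (M.jac t)⁻¹ * ∫⁻ x in M.D v, h (x, v) ∂M.μ else 0 := by
  let G : ι → Set E := fun v => {x | x ∈ M.D t ∧ M.Arrow t v ∧ M.T x ∈ M.D v}
  have hG : ∀ v, MeasurableSet (G v) := fun v => (M.measurableSet_D t).inter
    ((MeasurableSet.const _).inter (M.measurable_T (M.measurableSet_D v)))
  have hdisj : Pairwise (Function.onFun Disjoint G) := by
    intro v v' hv
    refine Set.disjoint_left.2 fun x hx hx' => hv ?_
    exact M.eq_of_arrow hx.2.1 hx'.2.1 hx.2.2 hx'.2.2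
  -- By `exhaust`, the sets `G v` cut the level, up to a null set, according to the level above the
  -- image point.
  have hae : (M.D t : Set E) =ᵐ[M.μ] (⋃ v, G v : Set E) := by
    have := (ae_restrict_iff' (M.measurableSet_D t)).1 (M.exhaust t)
    filter_upwards [this] with x hx
    apply propext
    change x ∈ M.D t ↔ x ∈ ⋃ v, G v
    simp only [mem_iUnion]
    constructor
    · intro h; obtain ⟨v, hv⟩ := hx h; exact ⟨v, h, hv⟩
    · rintro ⟨v, hv⟩; exact hv.1
  rw [setLIntegral_congr hae, lintegral_iUnion hG hdisj]
  refine tsum_congr fun v => ?_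
  split_ifs with hv
  · have hGv : G v = M.D t ∩ M.T ⁻¹' M.D v := by ext x; simp [G, hv]
    have h1 : ∫⁻ x in G v, h (M.step (x, t)) ∂M.μ = ∫⁻ x in G v, h (M.T x, v) ∂M.μ := by
      refine setLIntegral_congr_fun (hG v) fun x hx => ?_
      simp only [step]
      rw [M.next_eq hv hx.2.2]
    have hm : Measurable fun x => h (x, v) := hh.comp measurable_prodMk_right
    rw [h1, hGv, ← lintegral_map (f := fun x => h (x, v)) hm M.measurable_T, M.map_T_restrict hv,
      lintegral_smul_measure, smul_eq_mul]
  · have hGv : G v = ∅ := by ext x; simp [G, hv]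
    rw [hGv]; simp

/-- The measure with constant density `c u` on the level `u`. -/
def weight (c : ι → ℝ≥0∞) : Measure (E × ι) :=
  Measure.sum fun u => c u • (M.μ.restrict (M.D u)).map fun x => (x, u)

lemma lintegral_weight (c : ι → ℝ≥0∞) {h : E × ι → ℝ≥0∞} (hh : Measurable h) :
    ∫⁻ p, h p ∂(M.weight c) = ∑' u, c u * ∫⁻ x in M.D u, h (x, u) ∂M.μ := by
  rw [weight, lintegral_sum_measure]
  refine tsum_congr fun u => ?_
  rw [lintegral_smul_measure, lintegral_map hh measurable_prodMk_right, smul_eq_mul]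

open Classical in
/-- The transfer operator on densities that are constant on the levels. -/
def transfer (c : ι → ℝ≥0∞) (v : ι) : ℝ≥0∞ :=
  ∑' t, if M.Arrow t v then c t * (M.jac t)⁻¹ else 0

/-- Duality between `transfer` and composition with `step`: sum the transfer formula over the source
levels and exchange the two sums. -/
lemma lintegral_step_weight (c : ι → ℝ≥0∞) {h : E × ι → ℝ≥0∞} (hh : Measurable h) :
    ∑' t, c t * ∫⁻ x in M.D t, h (M.step (x, t)) ∂M.μ =
      ∑' v, M.transfer c v * ∫⁻ x in M.D v, h (x, v) ∂M.μ := by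
  classical
  simp_rw [M.lintegral_step _ hh, transfer, ← ENNReal.tsum_mul_left, ← ENNReal.tsum_mul_right]
  rw [ENNReal.tsum_comm]
  refine tsum_congr fun v => tsum_congr fun t => ?_
  split_ifs <;> ring

lemma map_step_weight (c : ι → ℝ≥0∞) :
    (M.weight c).map M.step = M.weight (M.transfer c) := by
  refine Measure.ext_of_lintegral _ fun h hh => ?_
  rw [lintegral_map hh M.measurable_step, M.lintegral_weight _ hh]
  refine (M.lintegral_weight c (hh.comp M.measurable_step)).trans ?_
  exact M.lintegral_step_weight c hh

/-- Conservation of mass: duality tested against the constant function `1`. -/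
lemma tsum_transfer_mul (c : ι → ℝ≥0∞) :
    ∑' v, M.transfer c v * M.μ (M.D v) = ∑' t, c t * M.μ (M.D t) := by
  have := M.lintegral_step_weight c (h := fun _ => 1) measurable_const
  simpa using this.symm

lemma tsum_arrow (t : ι) :
    (open Classical in ∑' v, if M.Arrow t v then (M.jac t)⁻¹ * M.μ (M.D v) else 0)
      = M.μ (M.D t) := by
  have := M.lintegral_step t (h := fun _ => 1) measurable_const
  simpa using this.symm

open Classical in
/-- The transition probabilities between the levels. -/
def prob (t v : ι) : ℝ≥0∞ :=
  if M.Arrow t v then (M.jac t)⁻¹ * M.μ (M.D v) / M.μ (M.D t) else 0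

lemma measure_mul_prob (t v : ι) : M.μ (M.D t) * M.prob t v =
    open Classical in if M.Arrow t v then (M.jac t)⁻¹ * M.μ (M.D v) else 0 := by
  classical
  rw [prob]
  split_ifs
  · rw [ENNReal.mul_div_cancel (M.pos t).ne' (measure_ne_top _ _)]
  · simp

lemma tsum_prob (t : ι) : ∑' v, M.prob t v = 1 := by
  have h : M.μ (M.D t) * ∑' v, M.prob t v = M.μ (M.D t) := by
    rw [← ENNReal.tsum_mul_left]
    simp_rw [measure_mul_prob]
    exact M.tsum_arrow t
  have h2 := congrArg (fun a => (M.μ (M.D t))⁻¹ * a) h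
  simpa [← mul_assoc, ENNReal.inv_mul_cancel (M.pos t).ne' (measure_ne_top _ _)] using h2

lemma tsum_mul_prob {c : ι → ℝ≥0∞} (hc : M.transfer c = c) (v : ι) :
    ∑' t, c t * M.μ (M.D t) * M.prob t v = c v * M.μ (M.D v) := by
  classical
  conv_rhs => rw [← hc]
  rw [transfer, ← ENNReal.tsum_mul_right]
  refine tsum_congr fun t => ?_
  rw [mul_assoc, measure_mul_prob]
  split_ifs <;> ring

/-- The points of the tower with a given finite itinerary. -/
def itinerary (n : ℕ) (w : ℕ → ι) : Set (E × ι) := {p | ∀ i ≤ n, (M.step^[i] p).2 = w i}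

lemma measurableSet_itinerary (n : ℕ) (w : ℕ → ι) : MeasurableSet (M.itinerary n w) := by
  have : M.itinerary n w = ⋂ i, ⋂ (_ : i ≤ n), (fun p => (M.step^[i] p).2) ⁻¹' {w i} := by
    ext p; simp [itinerary]
  rw [this]
  refine MeasurableSet.iInter fun i => MeasurableSet.iInter fun _ => ?_
  exact (measurable_snd.comp (M.measurable_step.iterate i)) (measurableSet_singleton _)

lemma itinerary_succ (n : ℕ) (w : ℕ → ι) (p : E × ι) : p ∈ M.itinerary (n + 1) w ↔
    p.2 = w 0 ∧ M.step p ∈ M.itinerary n fun i => w (i + 1) := by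
  simp only [itinerary, mem_ofPred_eq]
  constructor
  · intro h
    refine ⟨h 0 (Nat.zero_le _), fun i hi => ?_⟩
    rw [← Function.iterate_succ_apply]
    exact h (i + 1) (by omega)
  · rintro ⟨h0, h⟩ i hi
    cases i with
    | zero => exact h0
    | succ i => exact h i (by omega)

lemma lintegral_itinerary_of_ne {n : ℕ} {w : ℕ → ι} {v : ι} (hv : v ≠ w 0) :
    ∫⁻ x in M.D v, (M.itinerary n w).indicator 1 (x, v) ∂M.μ = 0 := by
  have : ∀ x : E, (M.itinerary n w).indicator (1 : E × ι → ℝ≥0∞) (x, v) = 0 := fun x =>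
    indicator_of_notMem (fun h : (x, v) ∈ M.itinerary n w => hv (h 0 (Nat.zero_le _))) _
  simp [this]

/-- The Markov property. Peeling off the first letter by the transfer formula leaves only the target
`w 1`; the branch covers all of that level with constant Jacobian, so the rest is the same integral
for the shifted word. -/
lemma lintegral_itinerary (n : ℕ) (w : ℕ → ι) :
    ∫⁻ x in M.D (w 0), (M.itinerary n w).indicator 1 (x, w 0) ∂M.μ =
      M.μ (M.D (w 0)) * ∏ i ∈ Finset.range n, M.prob (w i) (w (i + 1)) := by
  classical
  induction n generalizing w with
  | zero =>
    have : ∀ x : E, (M.itinerary 0 w).indicator (1 : E × ι → ℝ≥0∞) (x, w 0) = 1 := fun x =>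
      indicator_of_mem (by intro i hi; obtain rfl : i = 0 := by omega
                           rfl) _
    simp [this]
  | succ n ih =>
    have h1 : ∀ x : E, (M.itinerary (n + 1) w).indicator (1 : E × ι → ℝ≥0∞) (x, w 0) =
        (M.itinerary n fun i => w (i + 1)).indicator 1 (M.step (x, w 0)) := by
      intro x
      simp only [indicator_apply, itinerary_succ, true_and, Pi.one_apply]
    simp_rw [h1]
    rw [M.lintegral_step (w 0)
      (measurable_one.indicator (M.measurableSet_itinerary n fun i => w (i + 1))),
      tsum_eq_single (w 1)]
    · have := ih fun i => w (i + 1)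
      simp only [zero_add] at this
      rw [this, Finset.prod_range_succ', mul_comm (∏ k ∈ Finset.range n, _),
        zero_add, ← mul_assoc (M.μ (M.D (w 0))), measure_mul_prob]
      split_ifs <;> ring
    · intro v hv
      rw [M.lintegral_itinerary_of_ne (by simpa using hv)]
      simp

lemma weight_itinerary (c : ι → ℝ≥0∞) (n : ℕ) (w : ℕ → ι) :
    M.weight c (M.itinerary n w) =
      c (w 0) * M.μ (M.D (w 0)) * ∏ i ∈ Finset.range n, M.prob (w i) (w (i + 1)) := by
  rw [← lintegral_indicator_one (M.measurableSet_itinerary n w), M.lintegral_weight c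
    (measurable_one.indicator (M.measurableSet_itinerary n w)), tsum_eq_single (w 0),
    M.lintegral_itinerary, mul_assoc]
  intro v hv
  rw [M.lintegral_itinerary_of_ne hv, mul_zero]

end MarkovTower

/-! ### Separation of points and expansion along loops. -/

namespace MarkovTower

variable {E ι : Type*} [MeasurableSpace E] [Countable ι] [MeasurableSpace ι]
  [DiscreteMeasurableSpace ι] (M : MarkovTower E ι)

/-- Two points of `G` with the same itinerary in the tower coincide. -/
def Separates (G : Set E) : Prop :=
  ∀ x ∈ G, ∀ x' ∈ G, ∀ b : ℕ → ι,
    (∀ k, M.T^[k] x ∈ M.D (b k) ∧ M.T^[k] x' ∈ M.D (b k)) → x = x'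

lemma measure_inter_preimage_of_null {t v : ι} (h : M.Arrow t v) {B : Set E} (hB : B ⊆ M.D v)
    (h0 : M.μ B = 0) : M.μ (M.D t ∩ M.T ⁻¹' B) = 0 := by
  -- The Jacobian formula needs a measurable set inside `D v`, so the measurable hull is cut back to
  -- the level.
  let B' := toMeasurable M.μ B ∩ M.D v
  have hB' : M.μ B' = 0 := measure_mono_null inter_subset_left (by rwa [measure_toMeasurable])
  have hj := M.jacobian h B' ((measurableSet_toMeasurable _ _).inter (M.measurableSet_D v))
    inter_subset_right
  rw [hB', mul_eq_zero] at hj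
  refine measure_mono_null ?_ (hj.resolve_left (M.jac_ne_zero t))
  exact inter_subset_inter_right _ (preimage_mono (subset_inter (subset_toMeasurable _ _) hB))

lemma ae_of_ae_image {t v : ι} (h : M.Arrow t v) {p : E → Prop}
    (hp : ∀ᵐ x ∂M.μ, x ∈ M.D v → p x) : ∀ᵐ x ∂M.μ, x ∈ M.D t → M.T x ∈ M.D v → p (M.T x) := by
  have := M.measure_inter_preimage_of_null h (B := {x | x ∈ M.D v ∧ ¬ p x}) (fun x hx => hx.1)
    (by rw [ae_iff] at hp; simpa using hp)
  rw [ae_iff]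
  refine measure_mono_null (fun x hx => ?_) this
  simp only [mem_ofPred_eq, Classical.not_imp] at hx
  exact ⟨hx.1, hx.2.1, hx.2.2⟩

/-- If the Jacobian is `1` along a loop of arrows, then all points of a level have the same
itinerary. As the levels have no atoms, there is no such loop. -/
lemma exists_s_ne_one {G : Set E} (hG : M.μ Gᶜ = 0) (hsep : M.Separates G)
    (hatom : ∀ x, M.μ {x} = 0) {n : ℕ} (hn : 0 < n) (b : ℕ → ι)
    (hb : ∀ k < n, M.Arrow (b k) (b (k + 1))) (hloop : b n = b 0) : ∃ k < n, M.s (b k) ≠ 1 := by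
  by_contra! hs
  -- Separation compares infinite itineraries, so the loop is repeated periodically.
  let c : ℕ → ι := fun k => b (k % n)
  have hc : ∀ k, M.Arrow (c k) (c (k + 1)) := by
    intro k
    have hk := Nat.mod_lt k hn
    have h := hb _ hk
    rcases Nat.lt_or_ge (k % n + 1) n with h1 | h1
    · have : (k + 1) % n = k % n + 1 := by
        rw [Nat.add_mod, Nat.mod_eq_of_lt (a := 1) (by omega), Nat.mod_eq_of_lt h1]
      simpa [c, this] using h
    · have h2 : k % n + 1 = n := by omega
      have : (k + 1) % n = 0 := by
        rw [← Nat.mod_add_mod, h2, Nat.mod_self]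
      simp only [c, this]
      rwa [h2, hloop] at h
  have hsc : ∀ k, M.s (c k) = 1 := fun k => hs _ (Nat.mod_lt k hn)
  have hjac : ∀ k, M.μ (M.D (c k) ∩ M.T ⁻¹' M.D (c (k + 1))) = M.μ (M.D (c (k + 1))) := by
    intro k
    have := M.jacobian (hc k) _ (M.measurableSet_D _) subset_rfl
    simpa [hsc] using this
  have hanti : Antitone fun k => M.μ (M.D (c k)) := antitone_nat_of_succ_le fun k => by
    rw [← hjac k]; exact measure_mono inter_subset_left
  -- Jacobian `1` makes the measures of the levels nonincreasing along the path; going round the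
  -- loop brings back the initial value, so they are constant.
  have hconst : ∀ k, M.μ (M.D (c k)) = M.μ (M.D (c 0)) := by
    intro k
    refine le_antisymm (hanti (Nat.zero_le k)) ?_
    have : c 0 = c (n * k) := by simp [c]
    rw [this]
    exact hanti (Nat.le_mul_of_pos_left k hn)
  -- The part of the level that follows the arrow has the measure of the whole level, so almost
  -- nothing leaves along other arrows.
  have hstep : ∀ k, ∀ᵐ x ∂M.μ, x ∈ M.D (c k) → M.T x ∈ M.D (c (k + 1)) := by
    intro k
    have h0 : M.μ (M.D (c k) \ (M.D (c k) ∩ M.T ⁻¹' M.D (c (k + 1)))) = 0 := by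
      rw [measure_sdiff inter_subset_left ((M.measurableSet_D _).inter
        (M.measurable_T (M.measurableSet_D _))).nullMeasurableSet (measure_ne_top _ _), hjac,
        hconst, hconst (k + 1), tsub_self]
    rw [ae_iff]
    refine measure_mono_null (fun x hx => ?_) h0
    simp only [mem_ofPred_eq, Classical.not_imp] at hx
    exact ⟨hx.1, fun h => hx.2 h.2⟩
  have hiter : ∀ m k, ∀ᵐ x ∂M.μ, x ∈ M.D (c k) → M.T^[m] x ∈ M.D (c (k + m)) := by
    intro m
    induction m with
    | zero => intro k; exact Eventually.of_forall fun x hx => hx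
    | succ m ih =>
      intro k
      filter_upwards [hstep k, M.ae_of_ae_image (hc k) (ih (k + 1))] with x h1 h2 hx
      rw [Function.iterate_succ_apply, show k + (m + 1) = k + 1 + m by omega]
      exact h2 hx (h1 hx)
  have hall : ∀ᵐ x ∂M.μ, x ∈ M.D (c 0) → x ∈ G ∧ ∀ m, M.T^[m] x ∈ M.D (c m) := by
    have hG' : ∀ᵐ x ∂M.μ, x ∈ G := by rw [ae_iff]; exact hG
    filter_upwards [ae_all_iff.2 fun m => hiter m 0, hG'] with x hx hxG h0
    exact ⟨hxG, fun m => by simpa using hx m h0⟩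
  have hsub : ({x | x ∈ M.D (c 0) ∧ x ∈ G ∧ ∀ m, M.T^[m] x ∈ M.D (c m)} : Set E).Subsingleton :=
    fun x hx x' hx' => hsep x hx.2.1 x' hx'.2.1 c fun k => ⟨hx.2.2 k, hx'.2.2 k⟩
  have hnull : M.μ {x | x ∈ M.D (c 0) ∧ x ∈ G ∧ ∀ m, M.T^[m] x ∈ M.D (c m)} = 0 := by
    rcases hsub.eq_empty_or_singleton with h | ⟨x, h⟩
    · rw [h, measure_empty]
    · rw [h, hatom]
  refine (M.pos (c 0)).ne' (measure_mono_null_ae ?_ hnull)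
  filter_upwards [hall] with x hx h0
  exact ⟨h0, hx h0⟩

end MarkovTower

/-! ### Tiling an interval by consecutive intervals. -/

section Tiling

variable {ι : Type*} [LinearOrder ι] [WellFoundedLT ι]

open Classical in
/-- The sum of the terms that precede `u`. -/
def precedingSum (a : ι → ℝ) (u : ι) : ℝ := ∑' t, if t < u then a t else 0

lemma precedingSum_nonneg {a : ι → ℝ} (ha : ∀ t, 0 ≤ a t) (u : ι) : 0 ≤ precedingSum a u :=
  tsum_nonneg fun t => by split_ifs <;> simp [ha]

lemma precedingSum_add {a : ι → ℝ} (ha : ∀ t, 0 ≤ a t) (hs : Summable a) (u : ι) :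
    HasSum (open Classical in fun t => if t ≤ u then a t else 0) (precedingSum a u + a u) := by
  classical
  have h1 : Summable fun t => if t < u then a t else 0 :=
    Summable.of_nonneg_of_le (fun t => by split_ifs <;> simp [ha])
      (fun t => by split_ifs <;> simp [ha]) hs
  have h2 := h1.hasSum.add (hasSum_ite_eq u (a u))
  have h3 : (fun t => if t ≤ u then a t else 0) =
      fun t => (if t < u then a t else 0) + if t = u then a u else 0 := by
    funext t
    rcases lt_trichotomy t u with h | rfl | h
    · simp [h, h.le, h.ne]
    · simp
    · simp [h.not_ge, h.not_gt, h.ne']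
  rw [h3]
  exact h2

lemma precedingSum_add_le {a : ι → ℝ} (ha : ∀ t, 0 ≤ a t) (hs : Summable a) {u v : ι} (h : u < v) :
    precedingSum a u + a u ≤ precedingSum a v := by
  classical
  rw [← (precedingSum_add ha hs u).tsum_eq]
  refine (precedingSum_add ha hs u).summable.tsum_le_tsum (fun t => ?_)
    (Summable.of_nonneg_of_le (fun t => ?_) (fun t => ?_) hs)
  · by_cases h1 : t ≤ u
    · simp [h1, h1.trans_lt h]
    · simp only [h1, if_false]; split_ifs <;> simp [ha]
  all_goals split_ifs <;> simp [ha]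

lemma precedingSum_add_le_tsum {a : ι → ℝ} (ha : ∀ t, 0 ≤ a t) (hs : Summable a) (u : ι) :
    precedingSum a u + a u ≤ ∑' t, a t := by
  classical
  rw [← (precedingSum_add ha hs u).tsum_eq]
  exact (precedingSum_add ha hs u).summable.tsum_le_tsum (fun t => by split_ifs <;> simp [ha]) hs

/-- The tile of `u` in the partition of `[0, ∑ a)` into intervals of lengths `a t`. -/
def tile (a : ι → ℝ) (u : ι) : Set ℝ := Ico (precedingSum a u) (precedingSum a u + a u)

lemma eq_of_mem_tile {a : ι → ℝ} (ha : ∀ t, 0 ≤ a t) (hs : Summable a) {u v : ι} {y : ℝ}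
    (hu : y ∈ tile a u) (hv : y ∈ tile a v) : u = v := by
  rcases lt_trichotomy u v with h | h | h
  · have := precedingSum_add_le ha hs h; have := hu.2; have := hv.1; linarith
  · exact h
  · have := precedingSum_add_le ha hs h; have := hv.2; have := hu.1; linarith

lemma iUnion_tile {a : ι → ℝ} (ha : ∀ t, 0 ≤ a t) (hs : Summable a)
    (hfin : ∀ u : ι, (Iio u).Finite) : ⋃ u, tile a u = Ico 0 (∑' t, a t) := by
  classical
  ext y
  simp only [mem_iUnion]
  constructor
  · rintro ⟨u, hu⟩
    exact ⟨(precedingSum_nonneg ha u).trans hu.1, hu.2.trans_le (precedingSum_add_le_tsum ha hs u)⟩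
  · rintro ⟨h0, hy⟩
    -- A finite partial sum already exceeds `y`; its largest index serves as `u`.
    have hex : ∃ u, y < precedingSum a u + a u := by
      obtain ⟨F, hF⟩ := ((hs.hasSum.eventually (lt_mem_nhds hy)).exists)
      have hne : F.Nonempty := by
        rw [Finset.nonempty_iff_ne_empty]; rintro rfl; simp at hF; linarith
      refine ⟨F.max' hne, hF.trans_le ?_⟩
      have h1 := precedingSum_add ha hs (F.max' hne)
      calc ∑ t ∈ F, a t = ∑ t ∈ F, if t ≤ F.max' hne then a t else 0 :=
            Finset.sum_congr rfl fun t ht => by simp [F.le_max' t ht]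
        _ ≤ _ := sum_le_hasSum F (fun t _ => by split_ifs <;> simp [ha]) h1
    -- The first tile whose right end lies beyond `y`. If `y` were left of this tile, `u` would have
    -- a predecessor, as initial segments are finite, and the predecessor's right end is the left
    -- end of `u`, contradicting minimality.
    let u := wellFounded_lt.min {u | y < precedingSum a u + a u} hex
    have hu : y < precedingSum a u + a u := wellFounded_lt.min_mem _ hex
    refine ⟨u, ?_, hu⟩
    by_contra! hlt
    have hne : (hfin u).toFinset.Nonempty := by
      rw [Finset.nonempty_iff_ne_empty]
      intro he
      have : ∀ t, ¬ t < u := fun t ht => by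
        have : t ∈ (hfin u).toFinset := by simpa using ht
        simp [he] at this
      simp only [precedingSum, this, if_false, tsum_zero] at hlt
      linarith
    let w := (hfin u).toFinset.max' hne
    have hw : w < u := (hfin u).mem_toFinset.1 ((hfin u).toFinset.max'_mem hne)
    have hwu : precedingSum a u = precedingSum a w + a w := by
      rw [← (precedingSum_add ha hs w).tsum_eq, precedingSum]
      refine tsum_congr fun t => ?_
      have : t < u ↔ t ≤ w := ⟨fun h => (hfin u).toFinset.le_max' t (by simpa using h),
        fun h => h.trans_lt hw⟩
      simp [this]
    exact wellFounded_lt.not_lt_min {u | y < precedingSum a u + a u} (x := w)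
      (show y < _ by rw [← hwu]; exact hlt) hw

lemma lintegral_tiles [Countable ι] {a : ι → ℝ} (ha : ∀ t, 0 ≤ a t) {r : ℝ} (hs : HasSum a r)
    (hfin : ∀ u : ι, (Iio u).Finite) (g : ℝ → ℝ≥0∞) :
    ∑' u, ∫⁻ y in tile a u, g y = ∫⁻ y in Ico 0 r, g y := by
  rw [← hs.tsum_eq, ← iUnion_tile ha hs.summable hfin, lintegral_iUnion]
  · exact fun u => measurableSet_Ico
  · exact fun u v huv => Set.disjoint_left.2 fun y hu hv =>
      huv (eq_of_mem_tile ha hs.summable hu hv)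

end Tiling

lemma lintegral_Ico_affine {s : ℝ} (hs : 0 < s) (r o : ℝ) (g : ℝ → ℝ≥0∞) (hg : Measurable g) :
    ∫⁻ y in Ico 0 r, g (y / s + o) = ENNReal.ofReal s * ∫⁻ y in Ico o (o + r / s), g y := by
  rw [← lintegral_indicator measurableSet_Ico, ← lintegral_indicator measurableSet_Ico]
  have h : ∀ y, (Ico 0 r).indicator (fun y => g (y / s + o)) y =
      (Ico o (o + r / s)).indicator g (s⁻¹ * y + o) := by
    intro y
    have : y ∈ Ico 0 r ↔ s⁻¹ * y + o ∈ Ico o (o + r / s) := by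
      simp only [mem_Ico]
      rw [← div_eq_inv_mul, add_comm _ o, le_add_iff_nonneg_right, add_lt_add_iff_left,
        div_lt_div_iff_of_pos_right hs, le_div_iff₀ hs, zero_mul]
    simp only [indicator_apply, this]
    rw [div_eq_inv_mul y]
  simp_rw [h]
  have hm : Measurable ((Ico o (o + r / s)).indicator g) := hg.indicator measurableSet_Ico
  have h1 := lintegral_map (μ := volume) (f := fun z => (Ico o (o + r / s)).indicator g (z + o))
    (g := fun y => s⁻¹ * y) (hm.comp (measurable_add_const o)) (measurable_const_mul _)
  rw [← h1, Real.map_volume_mul_left (inv_ne_zero hs.ne'), lintegral_smul_measure, inv_inv,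
    abs_of_pos hs, smul_eq_mul, lintegral_add_right_eq_self]

/-! ### The skew product on the rugs. -/

namespace MarkovTower

variable {E ι : Type*} [MeasurableSpace E] [Countable ι] [MeasurableSpace ι]
  [DiscreteMeasurableSpace ι] (M : MarkovTower E ι) [LinearOrder ι] [WellFoundedLT ι]

open Classical in
/-- The heights of the images in the rug over `v` of the rugs over the levels `t`. -/
def height (ρ : ι → ℝ) (v t : ι) : ℝ := if M.Arrow t v then ρ t / M.s t else 0

/-- The skew product over the tower map. -/
def skew (ρ : ι → ℝ) (z : (E × ι) × ℝ) : (E × ι) × ℝ :=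
  (M.step z.1, z.2 / M.s z.1.2 + precedingSum (M.height ρ (M.next z.1)) z.1.2)

/-- The union of the half-open rugs. -/
def rugs (ρ : ι → ℝ) : Set ((E × ι) × ℝ) := {z | z.1.1 ∈ M.D z.1.2 ∧ z.2 ∈ Ico 0 (ρ z.1.2)}

/-- The natural measure on the rugs. -/
def rugMeasure (ρ : ι → ℝ) : Measure ((E × ι) × ℝ) :=
  ((M.weight 1).prod volume).restrict (M.rugs ρ)

lemma measurableSet_rugs (ρ : ι → ℝ) : MeasurableSet (M.rugs ρ) := by
  have h1 : MeasurableSet {p : E × ι | p.1 ∈ M.D p.2} := by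
    have : {p : E × ι | p.1 ∈ M.D p.2} = ⋃ t, M.D t ×ˢ {t} := by ext ⟨x, t⟩; simp
    rw [this]
    exact MeasurableSet.iUnion fun t => (M.measurableSet_D t).prod (measurableSet_singleton t)
  have h2 : Measurable fun z : (E × ι) × ℝ => ρ z.1.2 :=
    (Measurable.of_discrete (f := ρ)).comp (measurable_snd.comp measurable_fst)
  exact (measurable_fst h1).inter ((measurableSet_le measurable_const measurable_snd).inter
    (measurableSet_lt measurable_snd h2))

lemma measurable_skew (ρ : ι → ℝ) : Measurable (M.skew ρ) := by
  refine (M.measurable_step.comp measurable_fst).prodMk ?_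
  have hs : Measurable fun z : (E × ι) × ℝ => M.s z.1.2 :=
    (Measurable.of_discrete (f := M.s)).comp (measurable_snd.comp measurable_fst)
  have ho : Measurable fun q : ι × ι => precedingSum (M.height ρ q.1) q.2 := Measurable.of_discrete
  exact (measurable_snd.div hs).add (ho.comp
    ((M.measurable_next.comp measurable_fst).prodMk (measurable_snd.comp measurable_fst)))

instance (c : ι → ℝ≥0∞) : SFinite (M.weight c) := by
  unfold weight; infer_instance

lemma lintegral_rugMeasure (ρ : ι → ℝ) {h : (E × ι) × ℝ → ℝ≥0∞} (hh : Measurable h) :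
    ∫⁻ z, h z ∂(M.rugMeasure ρ) =
      ∑' t, ∫⁻ x in M.D t, (∫⁻ y in Ico 0 (ρ t), h ((x, t), y)) ∂M.μ := by
  have hi : Measurable ((M.rugs ρ).indicator h) := hh.indicator (M.measurableSet_rugs ρ)
  rw [rugMeasure, ← lintegral_indicator (M.measurableSet_rugs ρ),
    lintegral_prod _ hi.aemeasurable, M.lintegral_weight _ hi.lintegral_prod_right']
  refine tsum_congr fun t => ?_
  simp only [Pi.one_apply, one_mul]
  refine setLIntegral_congr_fun (M.measurableSet_D t) fun x hx => ?_
  rw [← lintegral_indicator measurableSet_Ico]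
  refine lintegral_congr fun y => ?_
  have hmem : ((x, t), y) ∈ M.rugs ρ ↔ y ∈ Ico 0 (ρ t) := ⟨fun h => h.2, fun h => ⟨hx, h⟩⟩
  classical simp only [indicator_apply, hmem]

lemma height_nonneg {ρ : ι → ℝ} (h0 : ∀ t, 0 ≤ ρ t) (v t : ι) : 0 ≤ M.height ρ v t := by
  unfold height; split_ifs
  · exact div_nonneg (h0 t) (M.s_pos t).le
  · exact le_rfl

/-- The fixed-point equation of the transfer operator, read in `ℝ`: the images arriving over `v`
have total height exactly `ρ v`. -/
lemma hasSum_height {ρ : ι → ℝ} (h0 : ∀ t, 0 ≤ ρ t)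
    (hρ : M.transfer (fun t => ENNReal.ofReal (ρ t)) = fun t => ENNReal.ofReal (ρ t)) (v : ι) :
    HasSum (M.height ρ v) (ρ v) := by
  have h := congrFun hρ v
  have h1 : M.transfer (fun t => ENNReal.ofReal (ρ t)) v =
      ∑' t, ENNReal.ofReal (M.height ρ v t) := by
    refine tsum_congr fun t => ?_
    unfold height
    split_ifs
    · rw [ENNReal.ofReal_div_of_pos (M.s_pos t), div_eq_mul_inv]; rfl
    · simp
  rw [h1] at h
  have h2 : HasSum (fun t => ENNReal.ofReal (M.height ρ v t)) (ENNReal.ofReal (ρ v)) := by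
    rw [← h]; exact ENNReal.summable.hasSum
  have h3 := ENNReal.hasSum_toReal (f := fun t => ENNReal.ofReal (M.height ρ v t))
    (by rw [h]; exact ENNReal.ofReal_ne_top)
  rw [← ENNReal.tsum_toReal_eq (fun _ => ENNReal.ofReal_ne_top), h] at h3
  simpa [ENNReal.toReal_ofReal, h0, M.height_nonneg h0] using h3

/-- The skew product preserves the natural measure on the rugs. -/
lemma measurePreserving_skew {ρ : ι → ℝ} (h0 : ∀ t, 0 ≤ ρ t) (hfin : ∀ u : ι, (Iio u).Finite)
    (hρ : M.transfer (fun t => ENNReal.ofReal (ρ t)) = fun t => ENNReal.ofReal (ρ t)) :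
    MeasurePreserving (M.skew ρ) (M.rugMeasure ρ) (M.rugMeasure ρ) := by
  classical
  refine ⟨M.measurable_skew ρ, Measure.ext_of_lintegral _ fun h hh => ?_⟩
  rw [lintegral_map hh (M.measurable_skew ρ), M.lintegral_rugMeasure ρ hh]
  refine (M.lintegral_rugMeasure ρ (hh.comp (M.measurable_skew ρ))).trans ?_
  -- The integral over the fibre of height `ρ t`, written as a function of the image base point, so
  -- that the transfer formula of the tower applies to it.
  let H : ι → E × ι → ℝ≥0∞ := fun t p =>
    ∫⁻ y in Ico 0 (ρ t), h (p, y / M.s t + precedingSum (M.height ρ p.2) t)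
  have hH : ∀ t, Measurable (H t) := by
    intro t
    have ho : Measurable fun q : ι => precedingSum (M.height ρ q) t := Measurable.of_discrete
    refine Measurable.lintegral_prod_right' (f := fun z : (E × ι) × ℝ =>
      h (z.1, z.2 / M.s t + precedingSum (M.height ρ z.1.2) t)) ?_
    exact hh.comp (measurable_fst.prodMk ((measurable_snd.div_const _).add
      (ho.comp (measurable_snd.comp measurable_fst))))
  -- The vertical change of variables yields a factor `s t`, which cancels the inverse Jacobian of
  -- the base.
  have hHt : ∀ t v x, M.Arrow t v →
      (M.jac t)⁻¹ * H t (x, v) = ∫⁻ y in tile (M.height ρ v) t, h ((x, v), y) := by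
    intro t v x hv
    simp only [H]
    rw [lintegral_Ico_affine (M.s_pos t) _ _ (fun y => h ((x, v), y))
      (hh.comp measurable_prodMk_left), ← mul_assoc]
    change (M.jac t)⁻¹ * M.jac t * _ = _
    rw [ENNReal.inv_mul_cancel (M.jac_ne_zero t) (M.jac_ne_top t), one_mul, tile]
    simp [height, hv]
  have key : ∀ t, ∫⁻ x in M.D t, (∫⁻ y in Ico 0 (ρ t), (h ∘ M.skew ρ) ((x, t), y)) ∂M.μ =
      ∑' v, ∫⁻ x in M.D v, (∫⁻ y in tile (M.height ρ v) t, h ((x, v), y)) ∂M.μ := by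
    intro t
    refine (M.lintegral_step t (hH t)).trans (tsum_congr fun v => ?_)
    split_ifs with hv
    · rw [← lintegral_const_mul (f := fun x => H t (x, v)) _ ((hH t).comp measurable_prodMk_right)]
      exact lintegral_congr fun x => hHt t v x hv
    · have : tile (M.height ρ v) t = ∅ := by simp [tile, height, hv]
      simp [this]
  simp_rw [key]
  rw [ENNReal.tsum_comm]
  refine tsum_congr fun v => ?_
  rw [← lintegral_tsum]
  · exact lintegral_congr fun x => lintegral_tiles (M.height_nonneg h0 v)
      (M.hasSum_height h0 hρ v) hfin _
  · intro t
    exact (Measurable.lintegral_prod_right' (f := fun z : E × ℝ => h ((z.1, v), z.2))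
      (hh.comp ((measurable_fst.prodMk measurable_const).prodMk measurable_snd))).aemeasurable

/-- The points of the rugs whose base point is mapped to a level of the tower. -/
def goodRugs (ρ : ι → ℝ) : Set ((E × ι) × ℝ) :=
  {z | z ∈ M.rugs ρ ∧ ∃ v, M.Arrow z.1.2 v ∧ M.T z.1.1 ∈ M.D v}

/-- The height of the image selects a tile, hence the source level; on a fixed level the base map is
injective and the vertical map is affine. -/
lemma injOn_skew {ρ : ι → ℝ} (h0 : ∀ t, 0 ≤ ρ t)
    (hρ : M.transfer (fun t => ENNReal.ofReal (ρ t)) = fun t => ENNReal.ofReal (ρ t)) :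
    InjOn (M.skew ρ) (M.goodRugs ρ) := by
  rintro ⟨⟨x, t⟩, y⟩ ⟨hz, v, hv, hTx⟩ ⟨⟨x', t'⟩, y'⟩ ⟨hz', v', hv', hTx'⟩ h
  simp only [skew, step, Prod.mk.injEq] at h
  obtain ⟨⟨h1, h2⟩, h3⟩ := h
  rw [M.next_eq hv hTx, M.next_eq hv' hTx'] at h2 h3
  subst h2
  have hmem : ∀ t y, M.Arrow t v → y ∈ Ico 0 (ρ t) →
      y / M.s t + precedingSum (M.height ρ v) t ∈ tile (M.height ρ v) t := by
    intro t y ht hy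
    simp only [tile, height, ht, if_true, mem_Ico]
    constructor
    · have := div_nonneg hy.1 (M.s_pos t).le; linarith
    · rw [add_comm]
      have := div_lt_div_of_pos_right hy.2 (M.s_pos t)
      simpa using this
  have ht : t = t' := by
    refine eq_of_mem_tile (M.height_nonneg h0 v) (M.hasSum_height h0 hρ v).summable
      (hmem t y hv hz.2) ?_
    rw [h3]
    exact hmem t' y' hv' hz'.2
  subst ht
  have hx : x = x' := M.injOn t hz.1 hz'.1 h1
  subst hx
  simp only [add_left_inj] at h3
  have := (div_left_inj' (M.s_pos t).ne').1 h3
  rw [this]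

lemma measurableSet_goodRugs (ρ : ι → ℝ) : MeasurableSet (M.goodRugs ρ) := by
  refine (M.measurableSet_rugs ρ).inter ?_
  have : {z : (E × ι) × ℝ | ∃ v, M.Arrow z.1.2 v ∧ M.T z.1.1 ∈ M.D v} =
      ⋃ v, (fun z => z.1.2) ⁻¹' {t | M.Arrow t v} ∩ (fun z => M.T z.1.1) ⁻¹' M.D v := by
    ext z; simp
  change MeasurableSet {z : (E × ι) × ℝ | ∃ v, M.Arrow z.1.2 v ∧ M.T z.1.1 ∈ M.D v}
  rw [this]
  refine MeasurableSet.iUnion fun v => MeasurableSet.inter ?_ ?_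
  · exact (measurable_snd.comp measurable_fst) (MeasurableSet.of_discrete)
  · exact (M.measurable_T.comp (measurable_fst.comp measurable_fst)) (M.measurableSet_D v)

lemma rugMeasure_compl_goodRugs (ρ : ι → ℝ) : M.rugMeasure ρ (M.goodRugs ρ)ᶜ = 0 := by
  rw [← lintegral_indicator_one (M.measurableSet_goodRugs ρ).compl, M.lintegral_rugMeasure ρ
    (measurable_one.indicator (M.measurableSet_goodRugs ρ).compl), ENNReal.tsum_eq_zero]
  intro t
  rw [← lintegral_zero]
  refine lintegral_congr_ae ?_
  filter_upwards [M.exhaust t, ae_restrict_mem (M.measurableSet_D t)] with x hx hxt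
  rw [← lintegral_zero]
  refine setLIntegral_congr_fun measurableSet_Ico fun y hy => ?_
  exact indicator_of_notMem (fun h : _ ∉ M.goodRugs ρ => h ⟨⟨hxt, hy⟩, hx⟩) _

lemma rugMeasure_univ {ρ : ι → ℝ} : M.rugMeasure ρ univ =
    ∑' t, ENNReal.ofReal (ρ t) * M.μ (M.D t) := by
  have := M.lintegral_rugMeasure ρ (h := fun _ => 1) measurable_const
  simpa using this

/-- An itinerary does not see the height; integrating the height out leaves the weight with density
`ρ`. -/
lemma rugMeasure_itinerary {ρ : ι → ℝ} (n : ℕ) (w : ℕ → ι) :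
    M.rugMeasure ρ (Prod.fst ⁻¹' M.itinerary n w) = ENNReal.ofReal (ρ (w 0)) * M.μ (M.D (w 0)) *
      ∏ i ∈ Finset.range n, M.prob (w i) (w (i + 1)) := by
  have hm := M.measurableSet_itinerary n w
  rw [← lintegral_indicator_one (measurable_fst hm), M.lintegral_rugMeasure ρ
    (measurable_one.indicator (measurable_fst hm)),
    ← M.weight_itinerary (fun t => ENNReal.ofReal (ρ t)), ← lintegral_indicator_one hm,
    M.lintegral_weight _ (measurable_one.indicator hm)]
  refine tsum_congr fun t => ?_
  rw [← lintegral_const_mul]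
  · refine lintegral_congr fun x => ?_
    have : ∀ y : ℝ, (Prod.fst ⁻¹' M.itinerary n w : Set ((E × ι) × ℝ)).indicator
        (1 : (E × ι) × ℝ → ℝ≥0∞) ((x, t), y) = (M.itinerary n w).indicator 1 (x, t) :=
      fun y => rfl
    simp [this, mul_comm]
  · exact (measurable_one.indicator hm).comp measurable_prodMk_right

end MarkovTower

/-! ### Invariant cores, two-sided orbits and recurrence. -/

section InvariantCore

variable {W : Type*} [MeasurableSpace W]

/-- `o` is a two-sided orbit of `F` in `Y`. -/
def IsOrbitIn (F : W → W) (Y : Set W) (o : ℤ → W) : Prop := ∀ k, o k ∈ Y ∧ F (o k) = o (k + 1)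

/-- `C` is a measurable set of full measure on which `F` is bijective, all of whose preimages in `Y`
lie in `C`. -/
structure IsInvariantCore (F : W → W) (Y : Set W) (ν : Measure W) (C : Set W) : Prop where
  subset : C ⊆ Y
  measurableSet : MeasurableSet C
  null : ν Cᶜ = 0
  bijOn : BijOn F C C
  mem_of_map_mem : ∀ z ∈ Y, F z ∈ C → z ∈ C

/-- A map that preserves the measure and is injective up to null sets has an invariant core. -/
theorem exists_isInvariantCore [StandardBorelSpace W] {ν : Measure W} {f F : W → W}
    (hf : MeasurePreserving f ν ν) {Y Y₀ Q : Set W} (hY₀ : MeasurableSet Y₀) (hsub : Y₀ ⊆ Y)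
    (h0 : ν Y₀ᶜ = 0) (hinj : InjOn f Y₀) (heq : EqOn F f Y₀) (hexc : ν (F '' (Y \ Y₀)) = 0)
    (hQ : ν Q = 0) :
    ∃ C, IsInvariantCore F Y ν C ∧ C ⊆ Y₀ ∧ Disjoint C Q := by
  have himg : ∀ A, MeasurableSet A → A ⊆ Y₀ → MeasurableSet (f '' A) := fun A hA hAY =>
    hA.image_of_measurable_injOn hf.measurable (hinj.mono hAY)
  -- A measure-preserving map controls preimages only. By injectivity the preimage of such an image
  -- adds nothing to the null set except points outside `Y₀`, so the image is null too.
  have hnull : ∀ A, ν A = 0 → ν (f '' (toMeasurable ν A ∩ Y₀)) = 0 := by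
    intro A hA
    have hm := (measurableSet_toMeasurable ν A).inter hY₀
    rw [← hf.measure_preimage (himg _ hm inter_subset_right).nullMeasurableSet]
    refine measure_mono_null (t := toMeasurable ν A ∪ Y₀ᶜ) ?_
      (measure_union_null (by rwa [measure_toMeasurable]) h0)
    intro z hz
    by_cases hzY : z ∈ Y₀
    · obtain ⟨z', hz', h⟩ := hz
      rw [← hinj hz'.2 hzY h]
      exact Or.inl hz'.1
    · exact Or.inr hzY
  have hrange : ν (f '' Y₀)ᶜ = 0 := by
    rw [← hf.measure_preimage (himg _ hY₀ subset_rfl).compl.nullMeasurableSet]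
    refine measure_mono_null (fun z hz hzY => hz ⟨z, hzY, rfl⟩) h0
  -- One round of saturation of a null set under images and preimages, with measurable hulls taken
  -- throughout. Iterating it and taking the union gives the complement of the core.
  let Φ : Set W → Set W := fun A => toMeasurable ν (toMeasurable ν A ∪ f '' (toMeasurable ν A ∩ Y₀) ∪
    f ⁻¹' toMeasurable ν A)
  -- The initial null set contains the points without preimage in `Y₀`, for surjectivity, and `F ''
  -- (Y \ Y₀)`, so that every preimage in `Y` of a core point lies in `Y₀`.
  let B : ℕ → Set W := fun n =>
    Φ^[n] (toMeasurable ν (Y₀ᶜ ∪ Q ∪ (f '' Y₀)ᶜ ∪ F '' (Y \ Y₀)))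
  have hBm : ∀ n, MeasurableSet (B n) := by
    intro n
    cases n with
    | zero => exact measurableSet_toMeasurable _ _
    | succ n =>
      simp only [B, Function.iterate_succ_apply']
      exact measurableSet_toMeasurable _ _
  have hB0 : ∀ n, ν (B n) = 0 := by
    intro n
    induction n with
    | zero =>
      simp only [B, Function.iterate_zero, id_eq, measure_toMeasurable]
      exact measure_union_null (measure_union_null (measure_union_null h0 hQ) hrange) hexc
    | succ n ih =>
      have hΦ : B (n + 1) = Φ (B n) := Function.iterate_succ_apply' _ _ _
      rw [hΦ]
      simp only [Φ, measure_toMeasurable]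
      have h1 : ν (toMeasurable ν (B n)) = 0 := by rwa [measure_toMeasurable]
      refine measure_union_null (measure_union_null h1 (hnull _ ih)) ?_
      rwa [hf.measure_preimage (measurableSet_toMeasurable _ _).nullMeasurableSet]
  have hstep : ∀ n, B n ∪ f '' (B n ∩ Y₀) ∪ f ⁻¹' B n ⊆ B (n + 1) := by
    intro n
    have hΦ : B (n + 1) = Φ (B n) := Function.iterate_succ_apply' _ _ _
    rw [hΦ]
    have h1 := subset_toMeasurable ν (B n)
    exact (union_subset_union (union_subset_union h1 (image_mono
      (inter_subset_inter_left _ h1))) (preimage_mono h1)).trans (subset_toMeasurable _ _)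
  have hmem : ∀ z, z ∈ (⋃ n, B n)ᶜ ↔ ∀ n, z ∉ B n := by intro z; simp
  have hbase : ∀ z ∈ (⋃ n, B n)ᶜ, z ∉ Y₀ᶜ ∪ Q ∪ (f '' Y₀)ᶜ ∪ F '' (Y \ Y₀) := fun z hz h =>
    (hmem z).1 hz 0 (subset_toMeasurable ν _ h)
  have hCY : (⋃ n, B n)ᶜ ⊆ Y₀ := fun z hz => by
    by_contra h
    exact hbase z hz (Or.inl (Or.inl (Or.inl h)))
  have hback : ∀ z ∈ Y, F z ∈ (⋃ n, B n)ᶜ → z ∈ (⋃ n, B n)ᶜ := by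
    intro z hz hFz
    have hzY : z ∈ Y₀ := by
      by_contra h
      exact hbase _ hFz (Or.inr ⟨z, ⟨hz, h⟩, rfl⟩)
    refine (hmem z).2 fun n hn => (hmem _).1 hFz (n + 1) (hstep n (Or.inl (Or.inr ?_)))
    exact ⟨z, ⟨hn, hzY⟩, (heq hzY).symm⟩
  refine ⟨(⋃ n, B n)ᶜ, ⟨hCY.trans hsub, (MeasurableSet.iUnion hBm).compl, ?_, ⟨?_, ?_, ?_⟩, hback⟩,
    hCY, ?_⟩
  · rw [compl_compl]; exact measure_iUnion_null hB0
  · intro z hz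
    rw [heq (hCY hz)]
    exact (hmem _).2 fun n hn => (hmem z).1 hz (n + 1) (hstep n (Or.inr hn))
  · exact (hinj.mono hCY).congr (heq.mono hCY).symm
  · intro z hz
    have hzr : z ∈ f '' Y₀ := by
      by_contra h
      exact hbase z hz (Or.inl (Or.inr h))
    obtain ⟨z', hz', rfl⟩ := hzr
    refine ⟨z', hback z' (hsub hz') ?_, heq hz'⟩
    rwa [heq hz']
  · exact Set.disjoint_left.2 fun z hz hzQ => hbase z hz (Or.inl (Or.inl (Or.inr hzQ)))

namespace IsInvariantCore

variable {F f : W → W} {Y C : Set W} {ν : Measure W} (hC : IsInvariantCore F Y ν C)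

/-- Backwards in time this rests on `mem_of_map_mem`: an orbit in `Y` cannot enter the core from
outside. Uniqueness of orbits depends on it. -/
lemma orbit_mem (hC : IsInvariantCore F Y ν C) {o : ℤ → W} (ho : IsOrbitIn F Y o) (h0 : o 0 ∈ C) (k : ℤ) : o k ∈ C := by
  induction k using Int.induction_on with
  | zero => exact h0
  | succ i ih => rw [← (ho i).2]; exact hC.bijOn.mapsTo ih
  | pred i ih =>
    refine hC.mem_of_map_mem _ (ho _).1 ?_
    rw [(ho _).2, sub_add_cancel]
    exact ih

/-- The restriction of the map to its invariant core, as a permutation. -/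
def perm : Equiv.Perm C := hC.bijOn.equiv F

lemma perm_apply (z : C) : (hC.perm z : W) = F z := rfl

/-- The orbit of a point of the invariant core. -/
def orbit (z : C) (k : ℤ) : C := (hC.perm ^ k) z

lemma orbit_add (z : C) (j k : ℤ) : hC.orbit z (j + k) = hC.orbit (hC.orbit z k) j := by
  simp only [orbit, zpow_add, Equiv.Perm.mul_apply]

lemma orbit_zero (z : C) : hC.orbit z 0 = z := by simp [orbit]

lemma orbit_one (z : C) : (hC.orbit z 1 : W) = F z := by simp [orbit, perm_apply]

lemma isOrbitIn_orbit (z : C) : IsOrbitIn F Y fun k => hC.orbit z k := by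
  intro k
  refine ⟨hC.subset (Subtype.coe_prop _), ?_⟩
  change F (hC.orbit z k) = hC.orbit z (k + 1)
  rw [add_comm k 1, orbit_add, orbit_one]

lemma eq_orbit {o : ℤ → W} (ho : IsOrbitIn F Y o) {z : C} (h0 : o 0 = z) (k : ℤ) :
    o k = hC.orbit z k := by
  have hmem := hC.orbit_mem ho (by rw [h0]; exact z.2)
  induction k using Int.induction_on with
  | zero => rw [h0, orbit_zero]
  | succ i ih =>
    rw [← (ho i).2, ih, (hC.isOrbitIn_orbit z i).2]
  | pred i ih =>
    refine hC.bijOn.injOn (hmem _) (Subtype.coe_prop _) ?_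
    have h1 := (ho (-i - 1)).2
    have h2 := (hC.isOrbitIn_orbit z (-i - 1)).2
    rw [sub_add_cancel] at h1 h2
    rw [h1, h2, ih]

lemma existsUnique_orbit (hC : IsInvariantCore F Y ν C) {z : W} (hz : z ∈ C) : ∃! o, IsOrbitIn F Y o ∧ o 0 = z := by
  refine ⟨fun k => hC.orbit ⟨z, hz⟩ k, ⟨hC.isOrbitIn_orbit _, by simp [orbit_zero]⟩, ?_⟩
  rintro o ⟨ho, h0⟩
  exact funext fun k => hC.eq_orbit ho (z := ⟨z, hz⟩) h0 k

lemma measurable_perm (hf : Measurable f) (heq : EqOn F f C) : Measurable hC.perm := by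
  refine Measurable.subtype_mk ?_
  have : (fun z : C => F z) = fun z : C => f z := funext fun z => heq z.2
  rw [this]
  exact hf.comp measurable_subtype_coe

variable [StandardBorelSpace W]

/-- Lusin–Souslin: an injective Borel map between standard Borel spaces sends Borel sets to Borel
sets. -/
lemma measurable_perm_symm (hf : Measurable f) (heq : EqOn F f C) : Measurable hC.perm.symm := by
  have := hC.measurableSet.standardBorel
  intro A hA
  rw [← Equiv.image_eq_preimage_symm]
  exact hA.image_of_measurable_injOn (hC.measurable_perm hf heq) hC.perm.injective.injOn

lemma measurable_orbit (hf : Measurable f) (heq : EqOn F f C) (k : ℤ) :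
    Measurable fun z => hC.orbit z k := by
  have h1 := hC.measurable_perm hf heq
  have h2 := hC.measurable_perm_symm hf heq
  induction k using Int.induction_on with
  | zero => simpa only [hC.orbit_zero] using measurable_id'
  | succ i ih =>
    have : (fun z => hC.orbit z (i + 1)) = hC.perm ∘ fun z => hC.orbit z i := by
      funext z; rw [add_comm]; simp only [orbit, zpow_add, zpow_one]; rfl
    rw [this]; exact h1.comp ih
  | pred i ih =>
    have : (fun z => hC.orbit z (-i - 1)) = hC.perm.symm ∘ fun z => hC.orbit z (-i) := by
      funext z
      rw [sub_eq_add_neg, add_comm]; simp only [orbit, zpow_add, zpow_neg_one]; rfl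
    rw [this]; exact h2.comp ih

/-- The core has full measure, so restricting to it changes no measure, even of a set that is not
measurable. -/
lemma comap_apply (hC : IsInvariantCore F Y ν C) (A : Set W) :
    ν.comap (Subtype.val : C → W) (Subtype.val ⁻¹' A) = ν A := by
  rw [comap_subtype_coe_apply hC.measurableSet, Subtype.image_preimage_coe]
  refine measure_congr ?_
  have : ∀ᵐ z ∂ν, z ∈ C := by rw [ae_iff]; exact hC.null
  filter_upwards [this] with z hz
  exact propext ⟨fun h => h.2, fun h => ⟨hz, h⟩⟩

lemma measurePreserving_perm (hf : MeasurePreserving f ν ν) (heq : EqOn F f C) :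
    MeasurePreserving hC.perm (ν.comap Subtype.val) (ν.comap Subtype.val) := by
  refine ⟨hC.measurable_perm hf.measurable heq, Measure.ext ?_⟩
  rintro _ ⟨B, hB, rfl⟩
  rw [Measure.map_apply (hC.measurable_perm hf.measurable heq) (measurable_subtype_coe hB),
    hC.comap_apply, ← hf.measure_preimage hB.nullMeasurableSet,
    ← hC.comap_apply]
  congr 1
  ext z
  change F z ∈ B ↔ f z ∈ B
  rw [heq z.2]

lemma measurePreserving_perm_symm (hf : MeasurePreserving f ν ν) (heq : EqOn F f C) :
    MeasurePreserving hC.perm.symm (ν.comap Subtype.val) (ν.comap Subtype.val) :=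
  MeasurePreserving.symm (e := ⟨hC.perm, hC.measurable_perm hf.measurable heq,
    hC.measurable_perm_symm hf.measurable heq⟩) (hC.measurePreserving_perm hf heq)

lemma measurePreserving_orbit (hf : MeasurePreserving f ν ν) (heq : EqOn F f C) (k : ℤ) :
    MeasurePreserving (fun z => hC.orbit z k) (ν.comap Subtype.val) (ν.comap Subtype.val) := by
  have h1 := hC.measurePreserving_perm hf heq
  have h2 := hC.measurePreserving_perm_symm hf heq
  induction k using Int.induction_on with
  | zero =>
    have : (fun z => hC.orbit z 0) = id := funext hC.orbit_zero
    rw [this]; exact MeasurePreserving.id _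
  | succ i ih =>
    have : (fun z => hC.orbit z (i + 1)) = hC.perm ∘ fun z => hC.orbit z i := by
      funext z; rw [add_comm]; simp only [orbit, zpow_add, zpow_one]; rfl
    rw [this]; exact h1.comp ih
  | pred i ih =>
    have : (fun z => hC.orbit z (-i - 1)) = hC.perm.symm ∘ fun z => hC.orbit z (-i) := by
      funext z
      rw [sub_eq_add_neg, add_comm]; simp only [orbit, zpow_add, zpow_neg_one]; rfl
    rw [this]; exact h2.comp ih

/-- In the past, almost every orbit visits one of countably many cells infinitely often. -/
theorem exists_recurrent (hC : IsInvariantCore F Y ν C) {ι : Type*} [Countable ι] [MeasurableSpace ι] [DiscreteMeasurableSpace ι]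
    [IsFiniteMeasure ν] (hf : MeasurePreserving f ν ν) (heq : EqOn F f C) {κ : W → ι}
    (hκ : Measurable κ) :
    ∃ C' ⊆ C, IsInvariantCore F Y ν C' ∧ ∀ o, IsOrbitIn F Y o → o 0 ∈ C' →
      ∃ u, ∃ᶠ n : ℕ in atTop, κ (o (-n)) = u := by
  let R : Set C := {z | ∃ u, ∃ᶠ n : ℕ in atTop, κ (hC.orbit z (-n)) = u}
  have hRm : MeasurableSet R := by
    have : R = ⋃ u, ⋂ N : ℕ, ⋃ n : ℕ, ⋃ _ : N ≤ n,
        (fun z => κ (hC.orbit z (-n))) ⁻¹' {u} := by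
      ext z; simp [R, frequently_atTop]
    rw [this]
    refine MeasurableSet.iUnion fun u => MeasurableSet.iInter fun N => MeasurableSet.iUnion fun n =>
      MeasurableSet.iUnion fun _ => ?_
    exact (hκ.comp (measurable_subtype_coe.comp (hC.measurable_orbit hf.measurable heq _)))
      (measurableSet_singleton u)
  have hfin : IsFiniteMeasure (ν.comap (Subtype.val : C → W)) :=
    ⟨(hC.comap_apply univ).trans_lt (measure_lt_top ν univ)⟩
  have hsymm : ∀ (n : ℕ) (z : C), hC.perm.symm^[n] z = hC.orbit z (-n) := by
    intro n z
    rw [orbit, zpow_neg, zpow_natCast, ← inv_pow, Equiv.Perm.coe_pow]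
    rfl
  have hRae : ∀ᵐ z ∂(ν.comap (Subtype.val : C → W)), z ∈ R := by
    -- Poincaré recurrence for the inverse map: almost every point returns in the past to its own
    -- cell, so `u = κ z` works.
    have hcons := (hC.measurePreserving_perm_symm hf heq).conservative
    have h1 : ∀ u, ∀ᵐ z : C ∂(ν.comap (Subtype.val : C → W)),
        κ z = u → ∃ᶠ n : ℕ in atTop, κ (hC.perm.symm^[n] z) = u := fun u =>
      hcons.ae_mem_imp_frequently_image_mem (s := {z : C | κ z = u})
        ((hκ.comp measurable_subtype_coe) (measurableSet_singleton u)).nullMeasurableSet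
    filter_upwards [ae_all_iff.2 h1] with z hz
    refine ⟨κ z, ?_⟩
    simpa [hsymm] using hz (κ z) rfl
  -- Moving the base point along its orbit shifts the times by one and does not affect infinitely
  -- many visits, so `R` is invariant and cuts out a smaller core.
  have hshift : ∀ z, hC.perm z ∈ R ↔ z ∈ R := by
    intro z
    refine exists_congr fun u => ?_
    have h : ∀ n : ℕ, hC.orbit (hC.perm z) (-((n + 1 : ℕ) : ℤ)) = hC.orbit z (-n) := by
      intro n
      have h1 : hC.perm z = hC.orbit z 1 := by simp [orbit]
      rw [h1, ← orbit_add]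
      congr 1; push_cast; ring
    simp only [frequently_atTop]
    constructor
    · intro hz N
      obtain ⟨n, hn, h2⟩ := hz (N + 1)
      obtain ⟨m, rfl⟩ : ∃ m, n = m + 1 := ⟨n - 1, by omega⟩
      exact ⟨m, by omega, by rw [← h2, h]⟩
    · intro hz N
      obtain ⟨n, hn, h2⟩ := hz N
      exact ⟨n + 1, by omega, by rw [h, h2]⟩
  refine ⟨Subtype.val '' R, by rintro _ ⟨z, _, rfl⟩; exact z.2, ⟨?_, ?_, ?_, ⟨?_, ?_, ?_⟩, ?_⟩, ?_⟩
  · rintro _ ⟨z, _, rfl⟩; exact hC.subset z.2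
  · exact hC.measurableSet.subtype_image hRm
  · have h1 : ν (Subtype.val '' Rᶜ) = 0 := by
      rw [← comap_subtype_coe_apply hC.measurableSet]; exact hRae
    refine measure_mono_null (fun z hz => ?_) (measure_union_null hC.null h1)
    by_cases hzC : z ∈ C
    · exact Or.inr ⟨⟨z, hzC⟩, fun h => hz ⟨_, h, rfl⟩, rfl⟩
    · exact Or.inl hzC
  · rintro _ ⟨z, hz, rfl⟩
    exact ⟨hC.perm z, (hshift z).2 hz, rfl⟩
  · refine hC.bijOn.injOn.mono ?_
    rintro _ ⟨z, _, rfl⟩; exact z.2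
  · rintro _ ⟨z, hz, rfl⟩
    refine ⟨hC.perm.symm z, ⟨_, (hshift _).1 (by simpa using hz), rfl⟩, ?_⟩
    rw [← hC.perm_apply, Equiv.apply_symm_apply]
  · rintro z hz ⟨z', hz', h⟩
    have hzC : z ∈ C := hC.mem_of_map_mem z hz (by rw [← h]; exact z'.2)
    refine ⟨⟨z, hzC⟩, (hshift _).1 ?_, rfl⟩
    have : hC.perm ⟨z, hzC⟩ = z' := Subtype.ext (by rw [perm_apply, h])
    rwa [this]
  · rintro o ho ⟨z, ⟨u, hu⟩, h⟩
    refine ⟨u, hu.mono fun n hn => ?_⟩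
    rw [hC.eq_orbit ho h.symm, hn]

end IsInvariantCore

end InvariantCore

/-! ### Uniqueness of two-sided Markov measures. -/

section MarkovMeasure

variable {ι : Type*} [Countable ι] [MeasurableSpace ι] [DiscreteMeasurableSpace ι]

/-- A two-sided Markov measure is determined by its initial vector and transition matrix. -/
theorem IsMarkovMeasure.unique {v : ι → ℝ≥0∞} {P : ι → ι → ℝ≥0∞} {m m' : Measure (ℤ → ι)}
    (h : IsMarkovMeasure v P m) (h' : IsMarkovMeasure v P m') : m = m' := by
  have := h.isProbability
  have := h'.isProbability
  -- On the window `[-n, n]` the configurations form a countable discrete space, so singletons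
  -- suffice, and these are cylinders of `2 * n + 1` letters.
  have key : ∀ n : ℕ, m.map (Finset.Icc (-(n : ℤ)) n).restrict =
      m'.map (Finset.Icc (-(n : ℤ)) n).restrict := by
    intro n
    refine Measure.ext_of_singleton fun a => ?_
    rw [Measure.map_apply (Finset.measurable_restrict _) (measurableSet_singleton a),
      Measure.map_apply (Finset.measurable_restrict _) (measurableSet_singleton a)]
    have hmem : ∀ i ≤ 2 * n, -(n : ℤ) + i ∈ Finset.Icc (-(n : ℤ)) n := fun i hi => by
      rw [Finset.mem_Icc]; omega
    have hne : (0 : ℤ) ∈ Finset.Icc (-(n : ℤ)) n := by rw [Finset.mem_Icc]; omega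
    -- Letters beyond `2 * n` do not enter the cylinder; the value at `0` is a filler.
    let w : ℕ → ι := fun i => if hi : i ≤ 2 * n then a ⟨-(n : ℤ) + i, hmem i hi⟩ else a ⟨0, hne⟩
    have hset : (Finset.Icc (-(n : ℤ)) n).restrict (π := fun _ => ι) ⁻¹' {a} =
        {b : ℤ → ι | ∀ i ≤ 2 * n, b (-(n : ℤ) + i) = w i} := by
      ext b
      constructor
      · intro hb i hi
        have := congrFun (show (Finset.Icc (-(n : ℤ)) n).restrict b = a from hb)
          ⟨-(n : ℤ) + i, hmem i hi⟩
        simpa [w, hi] using this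
      · intro hb
        refine funext fun ⟨k, hk⟩ => ?_
        have hk' := Finset.mem_Icc.1 hk
        have hi : (k + n).toNat ≤ 2 * n := by omega
        have h1 := hb (k + n).toNat hi
        have h2 : -(n : ℤ) + ((k + n).toNat : ℤ) = k := by omega
        simp only [w, hi, dif_pos, h2] at h1
        exact h1
    rw [hset, h.cylinder, h'.cylinder]
  -- Every finite set of coordinates lies in a symmetric window, so all finite-dimensional marginals
  -- agree.
  refine IsProjectiveLimit.unique (P := fun I : Finset ℤ => m'.map I.restrict) (fun I => ?_)
    (fun I => rfl)
  obtain ⟨n, hn⟩ : ∃ n : ℕ, I ⊆ Finset.Icc (-(n : ℤ)) n := by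
    refine ⟨I.sup Int.natAbs, fun k hk => ?_⟩
    have := Finset.le_sup (f := Int.natAbs) hk
    rw [Finset.mem_Icc]; omega
  have h1 : I.restrict (π := fun _ => ι) =
      Finset.restrict₂ hn ∘ (Finset.Icc (-(n : ℤ)) n).restrict := rfl
  rw [h1, ← Measure.map_map (Finset.measurable_restrict₂ hn) (Finset.measurable_restrict _), key,
    Measure.map_map (Finset.measurable_restrict₂ hn) (Finset.measurable_restrict _)]
  rfl

end MarkovMeasure

/-! ### Coding the points of an invariant core. -/

namespace IsInvariantCore

variable {W ι : Type*} [MeasurableSpace W] [StandardBorelSpace W] [Countable ι] [MeasurableSpace ι]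
  [DiscreteMeasurableSpace ι] {F f : W → W} {Y C : Set W} {ν : Measure W}
  (hC : IsInvariantCore F Y ν C)

/-- The sequence of cells visited by the orbit of a point of the core. -/
def code (κ : W → ι) (z : C) (k : ℤ) : ι := κ (hC.orbit z k)

lemma measurable_code (hf : Measurable f) (heq : EqOn F f C) {κ : W → ι} (hκ : Measurable κ) :
    Measurable (hC.code κ) :=
  measurable_pi_lambda _ fun k => hκ.comp (measurable_subtype_coe.comp (hC.measurable_orbit hf heq k))

lemma orbit_natCast (heq : EqOn F f C) (z : C) (n : ℕ) : (hC.orbit z n : W) = f^[n] z := by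
  induction n with
  | zero => simp [orbit_zero]
  | succ n ih =>
    rw [Function.iterate_succ_apply', ← ih, ← heq (Subtype.coe_prop _), (hC.isOrbitIn_orbit z n).2]
    rfl

lemma code_perm (κ : W → ι) (z : C) : hC.code κ (hC.perm z) = zshift (hC.code κ z) := by
  funext k
  have h1 : hC.perm z = hC.orbit z 1 := by simp [orbit]
  rw [zshift, code, code, h1, ← orbit_add]

/-- The code of a random point is distributed according to a Markov measure. -/
theorem isMarkovMeasure_map_code [IsProbabilityMeasure ν] (hf : MeasurePreserving f ν ν)
    (heq : EqOn F f C) {κ : W → ι} (hκ : Measurable κ) {v : ι → ℝ≥0∞} {P : ι → ι → ℝ≥0∞}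
    (hcyl : ∀ (n : ℕ) (w : ℕ → ι), ν {z | ∀ i ≤ n, κ (f^[i] z) = w i} =
      v (w 0) * ∏ i ∈ Finset.range n, P (w i) (w (i + 1))) :
    IsMarkovMeasure v P ((ν.comap Subtype.val).map (hC.code κ)) := by
  have hm := hC.measurable_code hf.measurable heq hκ
  refine ⟨⟨?_⟩, fun k n w => ?_⟩
  · rw [Measure.map_apply hm MeasurableSet.univ]
    exact (hC.comap_apply univ).trans measure_univ
  · have hcm : ∀ k : ℤ, MeasurableSet {b : ℤ → ι | ∀ i ≤ n, b (k + i) = w i} := by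
      intro k
      have : {b : ℤ → ι | ∀ i ≤ n, b (k + i) = w i} =
          ⋂ i, ⋂ _ : i ≤ n, (fun b : ℤ → ι => b (k + i)) ⁻¹' {w i} := by
        ext b; simp
      rw [this]
      exact MeasurableSet.iInter fun i => MeasurableSet.iInter fun _ =>
        (measurable_pi_apply _) (measurableSet_singleton _)
    have hs : (Subtype.val ⁻¹' {z : W | ∀ i ≤ n, κ (f^[i] z) = w i} : Set C) =
        hC.code κ ⁻¹' {b : ℤ → ι | ∀ i ≤ n, b (0 + i) = w i} := by
      ext z
      refine forall₂_congr fun i _ => ?_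
      rw [code, zero_add, hC.orbit_natCast heq]
    -- A cylinder based at time `k` is the preimage under `F^k` of the one based at `0`. Invariance
    -- thus reduces negative times to the forward itineraries of `hcyl`.
    have hs' : hC.code κ ⁻¹' {b : ℤ → ι | ∀ i ≤ n, b (k + i) = w i} =
        (fun z => hC.orbit z k) ⁻¹' (hC.code κ ⁻¹' {b : ℤ → ι | ∀ i ≤ n, b (0 + i) = w i}) := by
      ext z
      refine forall₂_congr fun i _ => ?_
      rw [code, code, zero_add, add_comm, orbit_add]
    rw [Measure.map_apply hm (hcm k), ← hcyl, ← hC.comap_apply, hs, hs',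
      (hC.measurePreserving_orbit hf heq k).measure_preimage (hm (hcm 0)).nullMeasurableSet]

/-- If the code determines the points of the core, then the coding map is an isomorphism. -/
theorem isIsomorphism_code [IsProbabilityMeasure ν] (hf : MeasurePreserving f ν ν)
    (heq : EqOn F f C) {κ : W → ι} (hκ : Measurable κ) (hinj : Function.Injective (hC.code κ))
    {ψ : W → ℤ → ι} (hψ : ∀ z : C, ψ z = hC.code κ z) :
    IsIsomorphism Y ν F (ψ '' Y) ((ν.comap Subtype.val).map (hC.code κ)) zshift ψ := by
  have hm := hC.measurable_code hf.measurable heq hκ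
  have := hC.measurableSet.standardBorel
  -- `ψ` is controlled only on `C`, where it is the code: a measurable injection on a standard Borel
  -- space.
  have himg : ∀ A ⊆ C, MeasurableSet A → MeasurableSet (ψ '' A) := by
    intro A hA hAm
    have : ψ '' A = hC.code κ '' (Subtype.val ⁻¹' A) := by
      ext b
      constructor
      · rintro ⟨z, hz, rfl⟩; exact ⟨⟨z, hA hz⟩, hz, (hψ ⟨z, hA hz⟩).symm⟩
      · rintro ⟨z, hz, rfl⟩; exact ⟨z, hz, hψ z⟩
    rw [this]
    exact (measurable_subtype_coe hAm).image_of_measurable_injOn hm hinj.injOn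
  have hinv : ∀ A : Set (ℤ → ι), C ∩ ψ ⁻¹' A = Subtype.val '' (hC.code κ ⁻¹' A) := by
    intro A
    ext z
    constructor
    · rintro ⟨hz, hA⟩; exact ⟨⟨z, hz⟩, by rwa [mem_preimage, ← hψ], rfl⟩
    · rintro ⟨z, hz, rfl⟩; exact ⟨z.2, by rwa [mem_preimage, hψ]⟩
  have hmeas : ∀ A, MeasurableSet A →
      (ν.comap Subtype.val).map (hC.code κ) A = ν (C ∩ ψ ⁻¹' A) := by
    intro A hA
    rw [Measure.map_apply hm hA, hinv, comap_subtype_coe_apply hC.measurableSet]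
  have hν : ν C = 1 := (prob_compl_eq_zero_iff hC.measurableSet).1 hC.null
  have hshift : ∀ z ∈ C, ψ (F z) = zshift (ψ z) := by
    intro z hz
    rw [hψ ⟨z, hz⟩, ← hC.code_perm, ← hψ]
    rfl
  refine ⟨C, hC.subset, ψ '' C, image_mono hC.subset, hC.measurableSet,
    himg C subset_rfl hC.measurableSet, hν, ?_, hC.bijOn.mapsTo, ?_, ⟨mapsTo_image _ _, ?_,
    surjOn_image _ _⟩, himg, ?_, hmeas, hshift⟩
  · rw [hmeas _ (himg C subset_rfl hC.measurableSet), inter_eq_left.2 (subset_preimage_image _ _),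
      hν]
  · rintro _ ⟨z, hz, rfl⟩
    exact ⟨F z, hC.bijOn.mapsTo hz, hshift z hz⟩
  · intro z hz z' hz' h
    have : (⟨z, hz⟩ : C) = ⟨z', hz'⟩ := hinj (by rw [← hψ, ← hψ]; exact h)
    exact congrArg Subtype.val this
  · intro A _ hA
    rw [hinv]
    exact hC.measurableSet.subtype_image (hm hA)

end IsInvariantCore

/-! ### Measurability and null sets for the piecewise system. -/

namespace PWSystem

section System

variable {E : Type*} [TopologicalSpace E] [PolishSpace E] [MeasurableSpace E] [BorelSpace E]
  {S : PWSystem E}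

/-- The points of `Z j` that lie in its interior and in no other piece. -/
def corePiece (S : PWSystem E) (j : Fin S.N) : Set E :=
  interior (S.Z j) \ ⋃ i, ⋃ _ : i ≠ j, S.Z i

lemma corePiece_subset_interior (j : Fin S.N) : S.corePiece j ⊆ interior (S.Z j) := sdiff_subset

lemma corePiece_subset (j : Fin S.N) : S.corePiece j ⊆ S.Z j :=
  (corePiece_subset_interior j).trans interior_subset

lemma eq_of_mem_corePiece {i j : Fin S.N} {x : E} (h : x ∈ S.corePiece j) (hi : x ∈ S.Z i) :
    i = j := by
  by_contra hij
  exact h.2 (mem_iUnion₂.2 ⟨i, hij, hi⟩)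

open Classical in
/-- A measurable version of `T`, which agrees with `T` on the core of each piece. -/
def measurableMap (S : PWSystem E) : E → E := (⋃ j, S.corePiece j).piecewise S.T id

lemma measurableMap_eq {j : Fin S.N} {x : E} (hx : x ∈ S.corePiece j) :
    S.measurableMap x = S.T x := by
  classical exact piecewise_eq_of_mem _ _ _ (mem_iUnion.2 ⟨j, hx⟩)

namespace Conditions

lemma isOpen_corePiece (hS : S.Conditions) (j : Fin S.N) : IsOpen (S.corePiece j) := by
  refine isOpen_interior.sdiff ?_
  exact isClosed_iUnion_of_finite fun i => isClosed_iUnion_of_finite fun _ => hS.closed i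

lemma measurableSet_X (hS : S.Conditions) : MeasurableSet S.X := hS.isCompact.isClosed.measurableSet

lemma inB_of_null (_ : S.Conditions) {A : Set E} (hA : A ⊆ S.X) (h0 : S.μ A = 0) : S.InB A :=
  ⟨hA, NullMeasurableSet.of_null h0⟩

lemma measure_image_null (hS : S.Conditions) {j : Fin S.N} {A : Set E} (hA : A ⊆ S.Z j)
    (h0 : S.μ A = 0) : S.μ (S.T '' A) = 0 := by
  rw [(hS.c4 j).2 A (hS.inB_of_null (hA.trans (hS.subset j)) h0) hA, h0, mul_zero]

lemma image_ae_eq (hS : S.Conditions) {j : Fin S.N} {A B : Set E} (hA : A ⊆ S.Z j)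
    (hB : B ⊆ S.Z j) (h : A =ᵐ[S.μ] B) : (S.T '' A : Set E) =ᵐ[S.μ] (S.T '' B : Set E) := by
  rw [ae_eq_set] at h ⊢
  have hdiff : ∀ A B : Set E, S.T '' A \ S.T '' B ⊆ S.T '' (A \ B) := by
    rintro A B _ ⟨⟨x, hx, rfl⟩, hB⟩
    exact ⟨x, ⟨hx, fun h => hB ⟨x, h, rfl⟩⟩, rfl⟩
  exact ⟨measure_mono_null (hdiff _ _) (hS.measure_image_null (sdiff_subset.trans hA) h.1),
    measure_mono_null (hdiff _ _) (hS.measure_image_null (sdiff_subset.trans hB) h.2)⟩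

lemma measure_preimage_null (hS : S.Conditions) {A : Set E} (h0 : S.μ A = 0) :
    S.μ (S.X ∩ S.T ⁻¹' A) = 0 := by
  have h1 : S.μ (A ∩ S.X) = 0 := measure_mono_null inter_subset_left h0
  refine measure_mono_null ?_ ((hS.c2 _ (hS.inB_of_null inter_subset_right h1)).2.2 h1)
  exact fun x hx => ⟨hx.1, hx.2, hS.mapsTo hx.1⟩

lemma ae_mem_X (hS : S.Conditions) : ∀ᵐ x ∂S.μ, x ∈ S.X := by rw [ae_iff]; exact hS.carrier

lemma ae_T (hS : S.Conditions) {p : E → Prop} (hp : ∀ᵐ x ∂S.μ, p x) : ∀ᵐ x ∂S.μ, p (S.T x) := by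
  rw [ae_iff] at hp
  have h := hS.measure_preimage_null hp
  have h' := measure_eq_zero_iff_ae_notMem.1 h
  filter_upwards [h', hS.ae_mem_X] with x hx hxX
  by_contra hpx
  exact hx ⟨hxX, hpx⟩

lemma ae_exists_mem (hS : S.Conditions) : ∀ᵐ x ∂S.μ, ∃ j, x ∈ S.Z j := by
  have := hS.isProbability
  have hm : MeasurableSet (⋃ j, S.Z j) := MeasurableSet.iUnion fun j => (hS.closed j).measurableSet
  have h := (prob_compl_eq_zero_iff hm).2 hS.cover
  rw [ae_iff]
  refine measure_mono_null (fun x hx => ?_) h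
  simpa using hx

/-- The boundary is null by the term `n = 0` of (c6), and the overlaps with other pieces are null by
`disj`. -/
lemma measure_sdiff_corePiece (hS : S.Conditions) (j : Fin S.N) :
    S.μ (S.Z j \ S.corePiece j) = 0 := by
  have h1 : S.μ (frontier (S.Z j)) = 0 := by
    refine measure_mono_null (fun x hx => ?_) hS.c6
    exact mem_iUnion.2 ⟨0, x, mem_iUnion.2 ⟨j, hx⟩, rfl⟩
  have h2 : S.μ (⋃ i, ⋃ _ : i ≠ j, S.Z i ∩ S.Z j) = 0 :=
    measure_iUnion_null fun i => measure_iUnion_null fun hi => hS.disj i j hi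
  refine measure_mono_null (fun x hx => ?_) (measure_union_null h1 h2)
  by_cases hi : x ∈ interior (S.Z j)
  · right
    have : x ∈ ⋃ i, ⋃ _ : i ≠ j, S.Z i := by
      by_contra h; exact hx.2 ⟨hi, h⟩
    obtain ⟨i, hij, hxi⟩ := mem_iUnion₂.1 this
    exact mem_iUnion₂.2 ⟨i, hij, hxi, hx.1⟩
  · left
    exact ⟨subset_closure hx.1, hi⟩

/-- `T` agrees with the continuous extension of (c1) on the interior, which is open in the ambient
space. -/
lemma continuousAt_T (hS : S.Conditions) {j : Fin S.N} {x : E} (hx : x ∈ S.corePiece j) :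
    ContinuousAt S.T x := by
  obtain ⟨g, ⟨hgc, -, hg⟩, -⟩ := hS.c1 j
  have hx' := corePiece_subset_interior j hx
  have h1 : ContinuousOn S.T (interior (S.Z j)) := by
    rw [continuousOn_iff_continuous_domRestrict]
    have : (interior (S.Z j)).domRestrict S.T =
        fun y : interior (S.Z j) => (g ⟨y, interior_subset y.2⟩ : E) := by
      funext y; exact (hg ⟨y, interior_subset y.2⟩ y.2).symm
    rw [this]
    exact continuous_subtype_val.comp (hgc.comp (by fun_prop))
  exact h1.continuousAt (isOpen_interior.mem_nhds hx')

lemma injOn_T (hS : S.Conditions) (j : Fin S.N) : InjOn S.T (S.corePiece j) := by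
  obtain ⟨g, ⟨-, hgi, hg⟩, -⟩ := hS.c1 j
  intro x hx y hy h
  have hx' := corePiece_subset_interior j hx
  have hy' := corePiece_subset_interior j hy
  have := @hgi ⟨x, interior_subset hx'⟩ ⟨y, interior_subset hy'⟩ (Subtype.ext (by
    rw [hg _ hx', hg _ hy']; exact h))
  exact congrArg Subtype.val this

lemma measurable_measurableMap (hS : S.Conditions) : Measurable S.measurableMap := by
  classical
  refine ContinuousOn.measurable_piecewise (fun x hx => ?_) continuousOn_id
    (isOpen_iUnion hS.isOpen_corePiece).measurableSet
  obtain ⟨j, hj⟩ := mem_iUnion.1 hx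
  exact (hS.continuousAt_T hj).continuousWithinAt

lemma inB_preimage_iterate (hS : S.Conditions) {A : Set E} (hA : S.InB A) (k : ℕ) :
    S.InB (S.X ∩ S.T^[k] ⁻¹' A) := by
  induction k with
  | zero => exact ⟨inter_subset_left, hS.measurableSet_X.nullMeasurableSet.inter hA.2⟩
  | succ k ih =>
    have : S.X ∩ S.T^[k + 1] ⁻¹' A = S.X ∩ S.T ⁻¹' (S.X ∩ S.T^[k] ⁻¹' A) := by
      ext x
      simp only [mem_inter_iff, mem_preimage, Function.iterate_succ_apply]
      exact ⟨fun h => ⟨h.1, hS.mapsTo h.1, h.2⟩, fun h => ⟨h.1, h.2.2⟩⟩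
    rw [this]
    exact (hS.c2 _ ih).2.1

lemma inB_image_iterate (hS : S.Conditions) {A : Set E} (hA : S.InB A) (k : ℕ) :
    S.InB (S.T^[k] '' A) := by
  induction k with
  | zero => simpa using hA
  | succ k ih =>
    rw [Function.iterate_succ', image_comp]
    exact (hS.c2 _ ih).1

lemma inB_cyl (hS : S.Conditions) {n : ℕ} (w : Fin (n + 1) → Fin S.N) : S.InB (S.cyl w) := by
  refine ⟨fun x hx => hx.1, ?_⟩
  have : S.cyl w = ⋂ k : Fin (n + 1), S.X ∩ S.T^[(k : ℕ)] ⁻¹' S.Z (w k) := by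
    ext x
    simp only [cyl, mem_ofPred_eq, mem_iInter, mem_inter_iff, mem_preimage]
    exact ⟨fun h k => ⟨h.1, h.2 k⟩, fun h => ⟨(h 0).1, fun k => (h k).2⟩⟩
  rw [this]
  exact NullMeasurableSet.iInter fun k => (hS.inB_preimage_iterate
    ⟨hS.subset _, (hS.closed _).measurableSet.nullMeasurableSet⟩ k).2

lemma inB_img (hS : S.Conditions) {n : ℕ} (w : Fin (n + 1) → Fin S.N) : S.InB (S.img w) :=
  hS.inB_image_iterate (hS.inB_cyl w) n

lemma measure_cyl_le (hS : S.Conditions) {n : ℕ} (w : Fin (n + 1) → Fin S.N) {k : ℕ} (hk : k ≤ n) :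
    S.μ (S.cyl w) ≤ S.μ (S.T^[k] '' S.cyl w) := by
  induction k with
  | zero => simp
  | succ k ih =>
    refine (ih (by omega)).trans ?_
    rw [Function.iterate_succ', image_comp,
      (hS.c4 (w ⟨k, by omega⟩)).2 _ (hS.inB_image_iterate (hS.inB_cyl w) k)]
    · refine le_mul_of_one_le_left zero_le ?_
      simpa using (hS.c4 (w ⟨k, by omega⟩)).1
    · rintro _ ⟨x, hx, rfl⟩
      exact hx.2 ⟨k, by omega⟩

end Conditions

lemma img_subset {n : ℕ} (w : Fin (n + 1) → Fin S.N) : S.img w ⊆ S.Z (w (Fin.last n)) := by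
  rintro _ ⟨x, hx, rfl⟩
  exact hx.2 (Fin.last n)

/-- This recursion makes the tower Markov: lengthening a word by one letter is the operation that
defines the arrows. -/
lemma img_snoc {n : ℕ} (w : Fin (n + 1) → Fin S.N) (j : Fin S.N) :
    S.img (Fin.snoc w j : Fin (n + 2) → Fin S.N) = S.Z j ∩ S.T '' S.img w := by
  ext y
  constructor
  · rintro ⟨x, hx, rfl⟩
    refine ⟨by simpa using hx.2 (Fin.last (n + 1)), S.T^[n] x, ⟨x, ⟨hx.1, fun k => ?_⟩, rfl⟩, ?_⟩
    · simpa using hx.2 k.castSucc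
    · rw [Function.iterate_succ_apply']
  · rintro ⟨hy, _, ⟨x, hx, rfl⟩, rfl⟩
    refine ⟨x, ⟨hx.1, fun k => ?_⟩, Function.iterate_succ_apply' _ _ _⟩
    refine Fin.lastCases ?_ (fun k => ?_) k
    · simpa [Function.iterate_succ_apply'] using hy
    · simpa using hx.2 k

/-- Up to a null set, a point is determined by the cylinder sets that contain it. -/
lemma Conditions.exists_separating (hS : S.Conditions) : ∃ G : Set E, S.μ Gᶜ = 0 ∧
    ∀ x ∈ G, ∀ x' ∈ G, (∀ A ∈ S.cylinders, x ∈ A ↔ x' ∈ A) → x = x' := by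
  let b := TopologicalSpace.countableBasis E
  have hb := TopologicalSpace.isBasis_countableBasis E
  have hc := TopologicalSpace.countable_countableBasis E
  have hex : ∀ B : b, ∃ A', MeasurableSet[MeasurableSpace.generateFrom S.cylinders] A' ∧
      A' =ᵐ[S.μ] (S.X ∩ B : Set E) := fun B => hS.c3 _ ⟨inter_subset_left,
    (hS.measurableSet_X.inter (hb.isOpen B.2).measurableSet).nullMeasurableSet⟩
  choose A hA hAB using hex
  have : Countable b := hc.to_subtype
  have hae : ∀ᵐ x ∂S.μ, x ∈ S.X ∧ ∀ B : b, x ∈ A B ↔ x ∈ S.X ∩ B := by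
    refine hS.ae_mem_X.and (ae_all_iff.2 fun B => ?_)
    filter_upwards [hAB B] with x hx
    exact iff_of_eq hx
  refine ⟨{x | x ∈ S.X ∧ ∀ B : b, x ∈ A B ↔ x ∈ S.X ∩ B}, ?_, ?_⟩
  · rw [ae_iff] at hae; exact hae
  · intro x hx x' hx' hcyl
    -- The sets that do not distinguish `x` from `x'` form a σ-algebra. It contains the cylinders,
    -- hence the approximants `A B` of a countable base, which distinguish points of `G`.
    have hgen : ∀ A', MeasurableSet[MeasurableSpace.generateFrom S.cylinders] A' →
        (x ∈ A' ↔ x' ∈ A') := by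
      intro A' hA'
      induction A', hA' using MeasurableSpace.generateFrom_induction with
      | hC t ht => exact hcyl t ht
      | empty => simp
      | compl t _ ih => exact not_congr ih
      | iUnion f _ ih => simp only [mem_iUnion, ih]
    have hB : ∀ B ∈ b, x ∈ B ↔ x' ∈ B := by
      intro B hB
      have h1 := hx.2 ⟨B, hB⟩
      have h2 := hx'.2 ⟨B, hB⟩
      have h3 := hgen _ (hA ⟨B, hB⟩)
      simp only [mem_inter_iff, hx.1, hx'.1, true_and] at h1 h2
      rw [← h1, ← h2, h3]
    by_contra hne
    obtain ⟨U, V, hU, -, hxU, hxV, hUV⟩ := t2_separation hne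
    obtain ⟨B, hBb, hxB, hBU⟩ := hb.exists_subset_of_mem_open hxU hU
    exact Set.disjoint_left.1 hUV (hBU ((hB B hBb).1 hxB)) hxV

end System

/-! ### The Hofbauer tower as a Markov tower. -/

namespace Tower

variable {E : Type*} [TopologicalSpace E] [PolishSpace E] [MeasurableSpace E] [BorelSpace E]
  {S : PWSystem E} (τ : Tower S) (hS : S.Conditions)

lemma inB_D (hS : S.Conditions) (u : τ.α) : S.InB (τ.D u) := by
  obtain ⟨n, w, -, -, h⟩ := τ.exists_word u
  exact ⟨(τ.D_subset u).trans (hS.subset _), (hS.inB_img w).2.congr h.symm⟩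

lemma measure_D_pos (hS : S.Conditions) (u : τ.α) : 0 < S.μ (τ.D u) := by
  obtain ⟨n, w, h0, -, h⟩ := τ.exists_word u
  rw [measure_congr h]
  exact h0.trans_le (hS.measure_cyl_le w le_rfl)

/-- A level has positive measure and distinct pieces overlap in null sets, so only one piece can
contain it. -/
lemma eq_last (hS : S.Conditions) {u : τ.α} {k : Fin S.N}
    (h : (τ.D u : Set E) ≤ᵐ[S.μ] S.Z k) : k = τ.last u := by
  by_contra hk
  refine (τ.measure_D_pos hS u).ne' (measure_mono_null_ae ?_ (hS.disj k (τ.last u) hk))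
  filter_upwards [h] with x hx hxu
  exact ⟨hx hxu, τ.D_subset u hxu⟩

lemma D_subset_iff (hS : S.Conditions) {u : τ.α} {k : Fin S.N} :
    τ.D u ⊆ S.Z k ↔ k = τ.last u :=
  ⟨fun h => τ.eq_last hS (LE.le.eventuallyLE h), fun h => h ▸ τ.D_subset u⟩

lemma Arrow.ae_eq {τ : Tower S} (hS : S.Conditions) {u v : τ.α} (h : τ.Arrow u v) :
    (τ.D v : Set E) =ᵐ[S.μ] (S.Z (τ.last v) ∩ S.T '' τ.D u : Set E) := by
  obtain ⟨j, -, hj⟩ := h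
  have : j = τ.last v := τ.eq_last hS (hj.le.trans (LE.le.eventuallyLE inter_subset_left))
  rwa [← this]

lemma Arrow.eq_of_last {τ : Tower S} (hS : S.Conditions) {u v v' : τ.α} (h : τ.Arrow u v)
    (h' : τ.Arrow u v') (hl : τ.last v = τ.last v') : v = v' := by
  refine τ.inj _ _ ((h.ae_eq hS).trans ?_)
  rw [hl]
  exact (h'.ae_eq hS).symm

/-- Append `j` to a word representing `D u`; the class of the longer word's image is listed in the
tower once its cylinder has positive measure. -/
lemma exists_arrow (hS : S.Conditions) {u : τ.α} {j : Fin S.N}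
    (h : 0 < S.μ (S.Z j ∩ S.T '' τ.D u)) :
    ∃ v, τ.Arrow u v ∧ (τ.D v : Set E) =ᵐ[S.μ] (S.Z j ∩ S.T '' τ.D u : Set E) := by
  obtain ⟨n, w, -, hw, hu⟩ := τ.exists_word u
  have h1 : (S.Z j ∩ S.T '' τ.D u : Set E) =ᵐ[S.μ]
      S.img (Fin.snoc w j : Fin (n + 2) → Fin S.N) := by
    rw [img_snoc]
    exact (ae_eq_refl _).inter (hS.image_ae_eq (τ.D_subset u) (hw ▸ img_subset w) hu)
  -- A null cylinder would have null images at every step, by (c4), up to the image `Z j ∩ T (D u)`,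
  -- which is not null.
  have h2 : 0 < S.μ (S.cyl (Fin.snoc w j : Fin (n + 2) → Fin S.N)) := by
    rw [pos_iff_ne_zero]
    intro h0
    refine h.ne' ?_
    rw [measure_congr h1, img_snoc]
    have h3 : ∀ k ≤ n, S.μ (S.T^[k] '' S.cyl (Fin.snoc w j : Fin (n + 2) → Fin S.N)) = 0 ∧
        S.T^[k] '' S.cyl (Fin.snoc w j : Fin (n + 2) → Fin S.N) ⊆
          S.Z ((Fin.snoc w j : Fin (n + 2) → Fin S.N) (Fin.ofNat (n + 2) k)) := by
      intro k hk
      have hsub : S.T^[k] '' S.cyl (Fin.snoc w j : Fin (n + 2) → Fin S.N) ⊆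
          S.Z ((Fin.snoc w j : Fin (n + 2) → Fin S.N) (Fin.ofNat (n + 2) k)) := by
        rintro _ ⟨x, hx, rfl⟩
        have := hx.2 (Fin.ofNat (n + 2) k)
        simpa [Nat.mod_eq_of_lt (show k < n + 2 by omega)] using this
      refine ⟨?_, hsub⟩
      induction k with
      | zero => simpa using h0
      | succ k ih =>
        rw [Function.iterate_succ', image_comp]
        refine hS.measure_image_null (j := (Fin.snoc w j : Fin (n + 2) → Fin S.N)
          (Fin.ofNat (n + 2) k)) ?_ (ih (by omega) ?_)
        all_goals
          rintro _ ⟨x, hx, rfl⟩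
          have := hx.2 (Fin.ofNat (n + 2) k)
          simpa [Nat.mod_eq_of_lt (show k < n + 2 by omega)] using this
    have h4 := hS.measure_image_null (h3 n le_rfl).2 (h3 n le_rfl).1
    rw [← image_comp, ← Function.iterate_succ'] at h4
    rw [← img_snoc]
    exact h4
  obtain ⟨v, hv⟩ := τ.exists_level _ _ h2
  have h5 := hv.trans h1.symm
  exact ⟨v, ⟨j, h, h5⟩, h5⟩

lemma exists_coreLevel (hS : S.Conditions) (u : τ.α) :
    ∃ A ⊆ τ.D u ∩ S.corePiece (τ.last u), MeasurableSet A ∧ A =ᵐ[S.μ] τ.D u := by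
  have h1 : (τ.D u ∩ S.corePiece (τ.last u) : Set E) =ᵐ[S.μ] τ.D u := by
    rw [ae_eq_set]
    refine ⟨by simp [sdiff_eq_empty.2 inter_subset_left], ?_⟩
    refine measure_mono_null (fun x hx => ?_) (hS.measure_sdiff_corePiece (τ.last u))
    exact ⟨τ.D_subset u hx.1, fun h => hx.2 ⟨hx.1, h⟩⟩
  obtain ⟨A, hA, hAm, hAe⟩ := ((τ.inB_D hS u).2.congr h1.symm).exists_measurable_subset_ae_eq
  exact ⟨A, hA, hAm, hAe.trans h1⟩

/-- A Borel set of full measure in the level `D u`, inside the core of the piece that contains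
`D u`. -/
def coreLevel (u : τ.α) : Set E := (τ.exists_coreLevel hS u).choose

lemma coreLevel_subset (u : τ.α) : τ.coreLevel hS u ⊆ τ.D u := fun _ hx =>
  ((τ.exists_coreLevel hS u).choose_spec.1 hx).1

lemma coreLevel_subset_corePiece (u : τ.α) : τ.coreLevel hS u ⊆ S.corePiece (τ.last u) :=
  fun _ hx => ((τ.exists_coreLevel hS u).choose_spec.1 hx).2

lemma measurableSet_coreLevel (u : τ.α) : MeasurableSet (τ.coreLevel hS u) :=
  (τ.exists_coreLevel hS u).choose_spec.2.1

lemma coreLevel_ae_eq (u : τ.α) : τ.coreLevel hS u =ᵐ[S.μ] τ.D u :=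
  (τ.exists_coreLevel hS u).choose_spec.2.2

lemma measurableMap_eq {u : τ.α} {x : E} (hx : x ∈ τ.coreLevel hS u) :
    S.measurableMap x = S.T x :=
  PWSystem.measurableMap_eq (τ.coreLevel_subset_corePiece hS u hx)

lemma eq_of_arrow_of_mem {t v v' : τ.α} {x : E} (h : τ.Arrow t v) (h' : τ.Arrow t v')
    (hx : x ∈ τ.coreLevel hS v) (hx' : x ∈ τ.D v') : v' = v :=
  h'.eq_of_last hS h (eq_of_mem_corePiece (τ.coreLevel_subset_corePiece hS v hx)
    (τ.D_subset v' hx'))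

lemma ae_exists_arrow (hS : S.Conditions) (t : τ.α) : ∀ᵐ x ∂S.μ, x ∈ τ.coreLevel hS t →
    ∃ v, τ.Arrow t v ∧ S.measurableMap x ∈ τ.coreLevel hS v := by
  have h1 : ∀ j, ∀ᵐ y ∂S.μ, y ∈ S.Z j → y ∈ S.T '' τ.D t →
      ∃ v, τ.Arrow t v ∧ y ∈ τ.coreLevel hS v := by
    intro j
    rcases eq_or_ne (S.μ (S.Z j ∩ S.T '' τ.D t)) 0 with h0 | h0
    · filter_upwards [measure_eq_zero_iff_ae_notMem.1 h0] with y hy hj hT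
      exact absurd ⟨hj, hT⟩ hy
    · obtain ⟨v, hv, hve⟩ := τ.exists_arrow hS (pos_iff_ne_zero.2 h0)
      filter_upwards [(τ.coreLevel_ae_eq hS v).trans hve] with y hy hj hT
      exact ⟨v, hv, (iff_of_eq hy).2 ⟨hj, hT⟩⟩
  filter_upwards [hS.ae_T (ae_all_iff.2 h1), hS.ae_T hS.ae_exists_mem] with x hx ⟨j, hj⟩ hxt
  rw [τ.measurableMap_eq hS hxt]
  exact hx j hj ⟨x, τ.coreLevel_subset hS t hxt, rfl⟩

lemma jacobian_coreLevel {t v : τ.α} (h : τ.Arrow t v) {B : Set E} (hB : MeasurableSet B)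
    (hBv : B ⊆ τ.coreLevel hS v) :
    ENNReal.ofReal (S.s (τ.last t)) * S.μ (τ.coreLevel hS t ∩ S.measurableMap ⁻¹' B) = S.μ B := by
  have hm : MeasurableSet (τ.coreLevel hS t ∩ S.measurableMap ⁻¹' B) :=
    (τ.measurableSet_coreLevel hS t).inter (hS.measurable_measurableMap hB)
  have hsub : τ.coreLevel hS t ∩ S.measurableMap ⁻¹' B ⊆ S.Z (τ.last t) :=
    inter_subset_left.trans ((τ.coreLevel_subset hS t).trans (τ.D_subset t))
  rw [← (hS.c4 (τ.last t)).2 _ ⟨hsub.trans (hS.subset _), hm.nullMeasurableSet⟩ hsub]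
  -- The image is `B` cut by `T (D t)` up to a null set, and an arrow means that `D v`, hence `B`,
  -- lies in `T (D t)` almost everywhere.
  have himg : S.T '' (τ.coreLevel hS t ∩ S.measurableMap ⁻¹' B) = S.T '' τ.coreLevel hS t ∩ B := by
    ext y
    constructor
    · rintro ⟨x, ⟨hx, hxB⟩, rfl⟩
      rw [mem_preimage, τ.measurableMap_eq hS hx] at hxB
      exact ⟨⟨x, hx, rfl⟩, hxB⟩
    · rintro ⟨⟨x, hx, rfl⟩, hB⟩
      exact ⟨x, ⟨hx, by rwa [mem_preimage, τ.measurableMap_eq hS hx]⟩, rfl⟩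
  rw [himg]
  refine measure_congr ?_
  have h1 := hS.image_ae_eq ((τ.coreLevel_subset hS t).trans (τ.D_subset t)) (τ.D_subset t)
    (τ.coreLevel_ae_eq hS t)
  filter_upwards [h1, h.ae_eq hS] with y hy1 hy2
  refine propext ⟨fun hy => hy.2, fun hy => ⟨?_, hy⟩⟩
  exact (iff_of_eq hy1).2 ((iff_of_eq hy2).1 (τ.coreLevel_subset hS v (hBv hy))).2

/-- The Hofbauer tower, restricted to Borel sets of full measure. -/
def markovTower : MarkovTower E τ.α where
  μ := S.μ
  finite := by have := hS.isProbability; infer_instance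
  T := S.measurableMap
  measurable_T := hS.measurable_measurableMap
  D := τ.coreLevel hS
  measurableSet_D := τ.measurableSet_coreLevel hS
  s u := S.s (τ.last u)
  one_le_s u := (hS.c4 _).1
  Arrow := τ.Arrow
  eq_of_arrow h h' hx hx' := (τ.eq_of_arrow_of_mem hS h h' hx (τ.coreLevel_subset hS _ hx')).symm
  exhaust t := (ae_restrict_iff' (τ.measurableSet_coreLevel hS t)).2 (τ.ae_exists_arrow hS t)
  jacobian h _ hB hBv := τ.jacobian_coreLevel hS h hB hBv
  injOn t x hx y hy h := by
    rw [τ.measurableMap_eq hS hx, τ.measurableMap_eq hS hy] at h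
    exact hS.injOn_T _ (τ.coreLevel_subset_corePiece hS t hx) (τ.coreLevel_subset_corePiece hS t hy) h
  pos u := by rw [measure_congr (τ.coreLevel_ae_eq hS u)]; exact τ.measure_D_pos hS u

lemma iterate_measurableMap {x : E} {b : ℕ → τ.α}
    (hb : ∀ k, S.measurableMap^[k] x ∈ τ.coreLevel hS (b k)) (k : ℕ) :
    S.measurableMap^[k] x = S.T^[k] x := by
  induction k with
  | zero => rfl
  | succ k ih =>
    rw [Function.iterate_succ_apply', τ.measurableMap_eq hS (hb k), ih,
      ← Function.iterate_succ_apply' S.T]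

/-- Core levels lie in core pieces, so the itinerary through the levels determines the itinerary
through the pieces, and with it every cylinder containing the point. -/
lemma exists_separates : ∃ G : Set E, S.μ Gᶜ = 0 ∧ (τ.markovTower hS).Separates G := by
  obtain ⟨G, hG, hsep⟩ := hS.exists_separating
  refine ⟨G, hG, fun x hx x' hx' b hb => hsep x hx x' hx' ?_⟩
  rintro _ ⟨n, w, -, rfl⟩
  have hmem : ∀ y, (∀ k, S.measurableMap^[k] y ∈ τ.coreLevel hS (b k)) →
      (y ∈ S.cyl w ↔ ∀ k : Fin (n + 1), w k = τ.last (b k)) := by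
    intro y hy
    have hyX : y ∈ S.X := hS.subset _ (τ.D_subset _ (τ.coreLevel_subset hS _ (hy 0)))
    simp only [cyl, mem_ofPred_eq, hyX, true_and]
    refine forall_congr' fun k => ?_
    rw [← τ.iterate_measurableMap hS hy]
    have h1 := τ.coreLevel_subset_corePiece hS _ (hy k)
    exact ⟨fun h => eq_of_mem_corePiece h1 h, fun h => h ▸ corePiece_subset _ h1⟩
  rw [hmem x fun k => (hb k).1, hmem x' fun k => (hb k).2]

end Tower
end PWSystem

/-! ### Weights on the tower and invariance of vague limits. -/

namespace MarkovTower

variable {E ι : Type*} [MeasurableSpace E] [Countable ι] [MeasurableSpace ι]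
  [DiscreteMeasurableSpace ι] (M : MarkovTower E ι)

lemma measurableSet_fiber (u : ι) : MeasurableSet {p : E × ι | p.2 = u} :=
  measurable_snd (measurableSet_singleton u)

lemma weight_restrict_fiber (c : ι → ℝ≥0∞) (u : ι) :
    (M.weight c).restrict {p | p.2 = u} = c u • (M.μ.restrict (M.D u)).map fun x => (x, u) := by
  refine Measure.ext_of_lintegral _ fun h hh => ?_
  rw [← lintegral_indicator (measurableSet_fiber u), M.lintegral_weight _
    (hh.indicator (measurableSet_fiber u)), lintegral_smul_measure,
    lintegral_map hh measurable_prodMk_right, smul_eq_mul, tsum_eq_single u]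
  · have : ∀ x : E, {p : E × ι | p.2 = u}.indicator h (x, u) = h (x, u) := fun x =>
      indicator_of_mem (s := {p : E × ι | p.2 = u}) rfl _
    simp_rw [this]
  · intro v hv
    have : ∀ x : E, {p : E × ι | p.2 = u}.indicator h (x, v) = 0 := fun x =>
      indicator_of_notMem (s := {p : E × ι | p.2 = u}) hv _
    simp [this]

lemma weight_fiber (c : ι → ℝ≥0∞) (u : ι) : M.weight c {p | p.2 = u} = c u * M.μ (M.D u) := by
  rw [← Measure.restrict_apply_univ, weight_restrict_fiber, Measure.smul_apply,
    Measure.map_apply measurable_prodMk_right MeasurableSet.univ]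
  simp

/-- A level of the Hofbauer tower need not be Borel; squeezing it between two measurable sets of
equal weight gives its measure all the same. -/
lemma weight_eq_of_subset (c : ι → ℝ≥0∞) {u : ι} {A : Set (E × ι)} (hA : A ⊆ {p | p.2 = u})
    (hD : M.D u ×ˢ {u} ⊆ A) : M.weight c A = c u * M.μ (M.D u) := by
  refine le_antisymm ((measure_mono hA).trans (M.weight_fiber c u).le) ?_
  refine le_trans ?_ (measure_mono hD)
  have h1 : M.D u ×ˢ {u} ⊆ {p : E × ι | p.2 = u} := hD.trans hA
  rw [← inter_eq_left.2 h1, ← Measure.restrict_apply ((M.measurableSet_D u).prod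
    (measurableSet_singleton u)), weight_restrict_fiber, Measure.smul_apply,
    Measure.map_apply measurable_prodMk_right ((M.measurableSet_D u).prod
    (measurableSet_singleton u)), smul_eq_mul]
  have : (fun x => (x, u)) ⁻¹' (M.D u ×ˢ {u}) = M.D u := by ext x; simp
  rw [this, Measure.restrict_apply_self]

lemma weight_univ (c : ι → ℝ≥0∞) : M.weight c univ = ∑' u, c u * M.μ (M.D u) := by
  have := M.lintegral_weight c (h := fun _ => 1) measurable_const
  simpa using this

lemma ae_weight (c : ι → ℝ≥0∞) {p : E × ι → Prop}
    (hp : ∀ u, ∀ᵐ x ∂(M.μ.restrict (M.D u)), p (x, u)) : ∀ᵐ q ∂(M.weight c), p q := by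
  rw [weight, Measure.ae_sum_iff]
  intro u
  refine Measure.ae_smul_measure ?_ _
  exact (MeasurableEmbedding.prodMk_right MeasurableEmbedding.id u).ae_map_iff.2 (hp u)

lemma integral_fiber_weight (c : ι → ℝ≥0∞) (u : ι) (f : E → ℝ) :
    ∫ p in {p | p.2 = u}, f p.1 ∂(M.weight c) = (c u).toReal * ∫ x in M.D u, f x ∂M.μ := by
  have h : MeasurableEmbedding fun x : E => (x, u) :=
    MeasurableEmbedding.prodMk_right MeasurableEmbedding.id u
  rw [weight_restrict_fiber, integral_smul_measure, h.integral_map, smul_eq_mul]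

lemma tsum_transfer_iterate (c : ι → ℝ≥0∞) (k : ℕ) :
    ∑' u, M.transfer^[k] c u * M.μ (M.D u) = ∑' u, c u * M.μ (M.D u) := by
  induction k with
  | zero => rfl
  | succ k ih => rw [Function.iterate_succ_apply', M.tsum_transfer_mul, ih]

/-- A vague limit of the Cesàro means of an orbit of the transfer operator is invariant, provided
that its total mass is finite. -/
theorem transfer_eq_of_tendsto {c : ℕ → ι → ℝ≥0∞} (hc : ∀ n, c (n + 1) = M.transfer (c n))
    (hfin : ∑' u, c 0 u * M.μ (M.D u) ≠ ∞) {r : ι → ℝ≥0∞}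
    (hr : ∀ u, Tendsto (fun n : ℕ => (n : ℝ≥0∞)⁻¹ * ∑ k ∈ Finset.range n, c k u) atTop (𝓝 (r u)))
    (hmass : ∑' u, r u * M.μ (M.D u) ≠ ∞) : M.transfer r = r := by
  classical
  have hcn : ∀ n, c n = M.transfer^[n] (c 0) := by
    intro n
    induction n with
    | zero => rfl
    | succ n ih => rw [hc, Function.iterate_succ_apply', ih]
  -- The conserved total mass bounds each single term uniformly in `n`.
  have hbound : ∀ n u, c n u ≤ (∑' u, c 0 u * M.μ (M.D u)) / M.μ (M.D u) := by
    intro n u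
    rw [ENNReal.le_div_iff_mul_le (Or.inl (M.pos u).ne') (Or.inl (measure_ne_top _ _)), hcn n,
      ← M.tsum_transfer_iterate (c 0) n]
    exact ENNReal.le_tsum u
  -- Fatou by hand: finite partial sums pass to the limit, and shifting the Cesàro window by one
  -- costs only the term `c n v / n`, which vanishes.
  have hle : ∀ v, M.transfer r v ≤ r v := by
    intro v
    rw [transfer]
    rw [ENNReal.tsum_eq_iSup_sum]
    refine iSup_le fun s => ?_
    have h1 : Tendsto (fun n : ℕ => ∑ t ∈ s, if M.Arrow t v then
        ((n : ℝ≥0∞)⁻¹ * ∑ k ∈ Finset.range n, c k t) * (M.jac t)⁻¹ else 0) atTop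
        (𝓝 (∑ t ∈ s, if M.Arrow t v then r t * (M.jac t)⁻¹ else 0)) := by
      refine tendsto_finsetSum _ fun t _ => ?_
      split_ifs
      · exact ENNReal.Tendsto.mul_const (hr t)
          (Or.inr (ENNReal.inv_ne_top.2 (M.jac_ne_zero t)))
      · exact tendsto_const_nhds
    have h2 : Tendsto (fun n : ℕ => (n : ℝ≥0∞)⁻¹ * ∑ k ∈ Finset.range n, c k v +
        (n : ℝ≥0∞)⁻¹ * ((∑' u, c 0 u * M.μ (M.D u)) / M.μ (M.D v))) atTop (𝓝 (r v + 0)) := by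
      refine (hr v).add ?_
      have := ENNReal.Tendsto.mul_const (b := (∑' u, c 0 u * M.μ (M.D u)) / M.μ (M.D v))
        ENNReal.tendsto_inv_nat_nhds_zero (Or.inr (ENNReal.div_ne_top hfin (M.pos v).ne'))
      simpa using this
    rw [add_zero] at h2
    refine le_of_tendsto_of_tendsto' h1 h2 fun n => ?_
    calc ∑ t ∈ s, (if M.Arrow t v then
          ((n : ℝ≥0∞)⁻¹ * ∑ k ∈ Finset.range n, c k t) * (M.jac t)⁻¹ else 0)
        = (n : ℝ≥0∞)⁻¹ * ∑ k ∈ Finset.range n, ∑ t ∈ s,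
            if M.Arrow t v then c k t * (M.jac t)⁻¹ else 0 := by
          rw [Finset.sum_comm, Finset.mul_sum]
          refine Finset.sum_congr rfl fun t _ => ?_
          split_ifs
          · rw [mul_assoc, Finset.sum_mul]
          · simp
      _ ≤ (n : ℝ≥0∞)⁻¹ * ∑ k ∈ Finset.range n, c (k + 1) v := by
          gcongr with k
          rw [hc, transfer]
          exact ENNReal.sum_le_tsum s
      _ ≤ (n : ℝ≥0∞)⁻¹ * (∑ k ∈ Finset.range n, c k v + c n v) := by
          gcongr
          rw [← Finset.sum_range_succ, Finset.sum_range_succ' (fun k => c k v)]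
          exact le_self_add
      _ ≤ _ := by
          rw [mul_add]
          gcongr
          exact hbound n v
  by_contra hne
  obtain ⟨v, hv⟩ := Function.ne_iff.1 hne
  -- Strict inequality at one level would lose mass, and finiteness of the total makes this a
  -- contradiction.
  have hlt : ∑' v, M.transfer r v * M.μ (M.D v) < ∑' v, r v * M.μ (M.D v) := by
    refine ENNReal.tsum_lt_tsum (i := v) (by rwa [M.tsum_transfer_mul]) (fun u => ?_) ?_
    · exact mul_le_mul_left (hle u) _
    · exact ENNReal.mul_lt_mul_left (M.pos v).ne' (measure_ne_top _ _) ((hle v).lt_of_ne hv)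
  rw [M.tsum_transfer_mul] at hlt
  exact hlt.false

end MarkovTower

namespace PWSystem.Tower

variable {E : Type*} [TopologicalSpace E] [PolishSpace E] [MeasurableSpace E] [BorelSpace E]
  {S : PWSystem E} (τ : Tower S) (hS : S.Conditions)

lemma mubar_eq : τ.mubar = (τ.markovTower hS).weight 1 := by
  rw [mubar, MarkovTower.weight]
  congr 1
  funext u
  rw [Pi.one_apply, one_smul]
  change _ = (S.μ.restrict (τ.coreLevel hS u)).map _
  rw [Measure.restrict_congr_set (τ.coreLevel_ae_eq hS u)]

lemma level_subset (u : τ.α) : τ.level u ⊆ {p | p.2 = u} := fun _ hp => hp.1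

lemma prod_subset_level (u : τ.α) : (τ.markovTower hS).D u ×ˢ {u} ⊆ τ.level u := by
  rintro ⟨x, v⟩ ⟨hx, rfl⟩
  exact ⟨rfl, τ.coreLevel_subset hS _ hx⟩

lemma weight_level (c : τ.α → ℝ≥0∞) (u : τ.α) :
    (τ.markovTower hS).weight c (τ.level u) = c u * (τ.markovTower hS).μ ((τ.markovTower hS).D u) :=
  (τ.markovTower hS).weight_eq_of_subset c (τ.level_subset u) (τ.prod_subset_level hS u)

/-- Both maps choose a target level. A point of a core level lies in no other piece, and a piece
contains at most one target of the arrows from `t`, so the choices agree. -/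
lemma That_eq_step {t v : τ.α} {x : E} (hx : x ∈ τ.coreLevel hS t) (h : τ.Arrow t v)
    (hv : S.measurableMap x ∈ τ.coreLevel hS v) :
    τ.That (x, t) = (τ.markovTower hS).step (x, t) := by
  have hT := τ.measurableMap_eq hS hx
  have hex : ∃ v, τ.Arrow t v ∧ S.T x ∈ τ.D v := ⟨v, h, by
    rw [← hT]; exact τ.coreLevel_subset hS v hv⟩
  have h1 : τ.That (x, t) = (S.T x, hex.choose) := dif_pos hex
  have h2 : (τ.markovTower hS).next (x, t) = v := (τ.markovTower hS).next_eq h hv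
  rw [h1, MarkovTower.step, h2, τ.eq_of_arrow_of_mem hS h hex.choose_spec.1 (hT ▸ hv)
    hex.choose_spec.2]
  exact Prod.ext hT.symm rfl

lemma That_ae_eq (c : τ.α → ℝ≥0∞) :
    τ.That =ᵐ[(τ.markovTower hS).weight c] (τ.markovTower hS).step := by
  refine (τ.markovTower hS).ae_weight c fun u => ?_
  filter_upwards [(τ.markovTower hS).exhaust u,
    ae_restrict_mem ((τ.markovTower hS).measurableSet_D u)] with x ⟨v, hv, hxv⟩ hx
  exact τ.That_eq_step hS hx hv hxv

/-- `That` is only almost everywhere equal to a measurable map. Each push-forward is again a weight,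
so this equality can be used anew at every iterate. -/
lemma map_That_iterate (c : τ.α → ℝ≥0∞) (k : ℕ) :
    AEMeasurable τ.That^[k] ((τ.markovTower hS).weight c) ∧
    ((τ.markovTower hS).weight c).map τ.That^[k] =
      (τ.markovTower hS).weight ((τ.markovTower hS).transfer^[k] c) := by
  induction k with
  | zero => exact ⟨aemeasurable_id, Measure.map_id⟩
  | succ k ih =>
    have h1 : AEMeasurable τ.That (((τ.markovTower hS).weight c).map τ.That^[k]) := by
      rw [ih.2]
      exact ⟨_, (τ.markovTower hS).measurable_step, τ.That_ae_eq hS _⟩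
    rw [Function.iterate_succ', Function.iterate_succ_apply']
    refine ⟨h1.comp_aemeasurable ih.1, ?_⟩
    rw [← AEMeasurable.map_map_of_aemeasurable h1 ih.1, ih.2, Measure.map_congr (τ.That_ae_eq hS _),
      (τ.markovTower hS).map_step_weight]

open Classical in
/-- The density of the base of the tower. -/
def baseDensity (u : τ.α) : ℝ≥0∞ := if (u : ℕ) < S.N then 1 else 0

lemma mubar_restrict_base :
    τ.mubar.restrict τ.base = (τ.markovTower hS).weight τ.baseDensity := by
  rw [τ.mubar_eq hS]
  have h1 : τ.base =ᵐ[(τ.markovTower hS).weight 1] {p : E × τ.α | (p.2 : ℕ) < S.N} := by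
    have : ∀ᵐ p ∂(τ.markovTower hS).weight 1, p.1 ∈ τ.D p.2 := by
      refine (τ.markovTower hS).ae_weight 1 fun u => ?_
      filter_upwards [ae_restrict_mem ((τ.markovTower hS).measurableSet_D u)] with x hx
      exact τ.coreLevel_subset hS u hx
    filter_upwards [this] with p hp
    exact propext ⟨fun h => h.1, fun h => ⟨h, hp⟩⟩
  have hm : MeasurableSet {p : E × τ.α | (p.2 : ℕ) < S.N} :=
    measurable_snd (MeasurableSet.of_discrete (s := {u : τ.α | (u : ℕ) < S.N}))
  rw [Measure.restrict_congr_set h1]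
  refine Measure.ext_of_lintegral _ fun h hh => ?_
  rw [← lintegral_indicator hm, MarkovTower.lintegral_weight _ _ (hh.indicator hm),
    MarkovTower.lintegral_weight _ _ hh]
  refine tsum_congr fun u => ?_
  by_cases hu : (u : ℕ) < S.N
  · have : ∀ x : E, {p : E × τ.α | (p.2 : ℕ) < S.N}.indicator h (x, u) = h (x, u) := fun x =>
      indicator_of_mem (s := {p : E × τ.α | (p.2 : ℕ) < S.N}) hu _
    simp_rw [this]
    simp [baseDensity, hu]
  · have : ∀ x : E, {p : E × τ.α | (p.2 : ℕ) < S.N}.indicator h (x, u) = 0 := fun x =>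
      indicator_of_notMem (s := {p : E × τ.α | (p.2 : ℕ) < S.N}) hu _
    simp_rw [this]
    simp [baseDensity, hu]

lemma tsum_baseDensity_ne_top :
    ∑' u, τ.baseDensity u * (τ.markovTower hS).μ ((τ.markovTower hS).D u) ≠ ∞ := by
  have hfin : {u : τ.α | (u : ℕ) < S.N}.Finite :=
    Set.Finite.preimage Subtype.val_injective.injOn (Set.finite_Iio S.N)
  rw [tsum_eq_sum (s := hfin.toFinset)]
  · refine ENNReal.sum_ne_top.2 fun u _ => ENNReal.mul_ne_top ?_ (measure_ne_top _ _)
    unfold baseDensity; split_ifs <;> simp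
  · intro u hu
    have : ¬ (u : ℕ) < S.N := by simpa using hu
    simp [baseDensity, this]

/-- The density of the Cesàro means. -/
def cesaroDensity (n : ℕ) (u : τ.α) : ℝ≥0∞ :=
  (n : ℝ≥0∞)⁻¹ * ∑ k ∈ Finset.range n, (τ.markovTower hS).transfer^[k] τ.baseDensity u

lemma cesaro_eq (n : ℕ) : τ.cesaro n = (τ.markovTower hS).weight (τ.cesaroDensity hS n) := by
  rw [cesaro, τ.mubar_restrict_base hS]
  refine Measure.ext_of_lintegral _ fun h hh => ?_
  rw [lintegral_smul_measure, lintegral_finsetSum_measure, MarkovTower.lintegral_weight _ _ hh]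
  simp_rw [(τ.map_That_iterate hS _ _).2, MarkovTower.lintegral_weight _ _ hh]
  rw [← Summable.tsum_finsetSum (fun _ _ => ENNReal.summable), smul_eq_mul,
    ← ENNReal.tsum_mul_left]
  refine tsum_congr fun u => ?_
  rw [cesaroDensity, mul_assoc, Finset.sum_mul]

/-- A vague limit of the Cesàro means has a constant density on each level, and it is invariant. -/
theorem exists_density {μhat : Measure (E × τ.α)} [IsProbabilityMeasure μhat]
    (hlift : τ.IsVagueLimit μhat) : ∃ r : τ.α → ℝ, (∀ u, 0 ≤ r u) ∧
      μhat = (τ.markovTower hS).weight (fun u => ENNReal.ofReal (r u)) ∧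
      (τ.markovTower hS).transfer (fun u => ENNReal.ofReal (r u)) =
        fun u => ENNReal.ofReal (r u) := by
  set M := τ.markovTower hS with hM
  let _ := TopologicalSpace.upgradeIsCompletelyMetrizable E
  let m : τ.α → Measure E := fun u => (μhat.restrict {p | p.2 = u}).map Prod.fst
  have hmfin : ∀ u, IsFiniteMeasure (m u) := fun u => by infer_instance
  have hpos : ∀ u, 0 < M.μ.real (M.D u) := fun u =>
    ENNReal.toReal_pos (M.pos u).ne' (measure_ne_top _ _)
  have hint : ∀ u (f : E →ᵇ ℝ), Tendsto (fun n => (τ.cesaroDensity hS n u).toReal *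
      ∫ x in M.D u, f x ∂M.μ) atTop (𝓝 (∫ x, f x ∂(m u))) := by
    intro u f
    have h := hlift u f
    simp_rw [τ.cesaro_eq hS, MarkovTower.integral_fiber_weight] at h
    rwa [integral_map measurable_fst.aemeasurable f.continuous.aestronglyMeasurable]
  let r : τ.α → ℝ := fun u => (m u).real univ / M.μ.real (M.D u)
  have hr0 : ∀ u, 0 ≤ r u := fun u => div_nonneg measureReal_nonneg measureReal_nonneg
  -- Testing with `f = 1` isolates the density, which then determines the limit on every other test
  -- function.
  have hlim : ∀ u, Tendsto (fun n => (τ.cesaroDensity hS n u).toReal) atTop (𝓝 (r u)) := by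
    intro u
    have h := (hint u (BoundedContinuousFunction.const E 1)).div_const (M.μ.real (M.D u))
    simp only [BoundedContinuousFunction.const_apply, integral_const, smul_eq_mul, mul_one,
      measureReal_restrict_apply_univ] at h
    refine h.congr fun n => ?_
    rw [mul_div_assoc, div_self (hpos u).ne', mul_one]
  have hm : ∀ u, m u = ENNReal.ofReal (r u) • M.μ.restrict (M.D u) := by
    intro u
    have : IsFiniteMeasure (ENNReal.ofReal (r u) • M.μ.restrict (M.D u)) :=
      Measure.smul_finite _ ENNReal.ofReal_ne_top
    refine ext_of_forall_integral_eq_of_IsFiniteMeasure fun f => ?_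
    rw [integral_smul_measure, ENNReal.toReal_ofReal (hr0 u)]
    exact tendsto_nhds_unique (hint u f) ((hlim u).mul_const _)
  have hμ : μhat = M.weight (fun u => ENNReal.ofReal (r u)) := by
    refine Measure.ext_of_lintegral _ fun h hh => ?_
    have hU : (⋃ u, {p : E × τ.α | p.2 = u}) = univ := by ext p; simp
    rw [M.lintegral_weight _ hh, ← setLIntegral_univ, ← hU,
      lintegral_iUnion (fun u => MarkovTower.measurableSet_fiber u)
      (fun u v huv => Set.disjoint_left.2 fun p (hp : p.2 = u) (hp' : p.2 = v) =>
        huv (hp.symm.trans hp'))]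
    refine tsum_congr fun u => ?_
    have h1 : ∫⁻ p in {p : E × τ.α | p.2 = u}, h p ∂μhat =
        ∫⁻ p in {p : E × τ.α | p.2 = u}, h (p.1, u) ∂μhat :=
      setLIntegral_congr_fun (MarkovTower.measurableSet_fiber u) fun p (hp : p.2 = u) => by
        rw [← hp]
    have h2 : ∫⁻ x, h (x, u) ∂(m u) = ∫⁻ p in {p : E × τ.α | p.2 = u}, h (p.1, u) ∂μhat :=
      lintegral_map (f := fun x => h (x, u)) (hh.comp measurable_prodMk_right) measurable_fst
    rw [h1, ← h2, hm, lintegral_smul_measure, smul_eq_mul]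
  refine ⟨r, hr0, hμ, ?_⟩
  have hmass : ∑' u, ENNReal.ofReal (r u) * M.μ (M.D u) = 1 := by
    rw [← M.weight_univ, ← hμ, measure_univ]
  have hK := τ.tsum_baseDensity_ne_top hS
  have hcfin : ∀ k u, M.transfer^[k] τ.baseDensity u ≠ ∞ := by
    intro k u htop
    rw [← M.tsum_transfer_iterate τ.baseDensity k] at hK
    refine hK (top_le_iff.1 (le_trans ?_ (ENNReal.le_tsum u)))
    rw [htop, ENNReal.top_mul (M.pos u).ne']
  refine M.transfer_eq_of_tendsto (c := fun k => M.transfer^[k] τ.baseDensity)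
    (fun k => Function.iterate_succ_apply' _ _ _) hK (fun u => ?_) (by rw [hmass]; simp)
  have h1 := ENNReal.tendsto_ofReal (hlim u)
  refine h1.congr' ?_
  -- For `n > 0` the prefactor is finite, so passing through `toReal` loses nothing.
  filter_upwards [eventually_gt_atTop 0] with n hn
  rw [ENNReal.ofReal_toReal]
  · rfl
  · exact ENNReal.mul_ne_top (ENNReal.inv_ne_top.2 (by exact_mod_cast hn.ne'))
      (ENNReal.sum_ne_top.2 fun k _ => hcfin k u)

end PWSystem.Tower

/-! ### Contraction of heights and injectivity of the coding. -/

lemma le_prod_range {f : ℕ → ℝ} (hf : ∀ i, 1 ≤ f i) (n : ℕ) :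
    1 ≤ ∏ i ∈ Finset.range n, f i ∧ ∀ j < n, f j ≤ ∏ i ∈ Finset.range n, f i := by
  induction n with
  | zero => simp
  | succ n ih =>
    rw [Finset.prod_range_succ]
    have h1 := hf n
    refine ⟨by nlinarith [ih.1], fun j hj => ?_⟩
    rcases Nat.lt_succ_iff_lt_or_eq.1 hj with h | rfl
    · have := ih.2 j h; nlinarith [ih.1]
    · nlinarith [ih.1]

namespace MarkovTower

variable {E ι : Type*} [MeasurableSpace E] [Countable ι] [MeasurableSpace ι]
  [DiscreteMeasurableSpace ι] (M : MarkovTower E ι)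

/-- Along a path of arrows that visits one level infinitely often in the past, a sequence that is
contracted by the inverse Jacobians and bounded on each level vanishes. -/
theorem eq_zero_of_contracted {G : Set E} (hG : M.μ Gᶜ = 0) (hsep : M.Separates G)
    (hatom : ∀ x, M.μ {x} = 0) {l : ℝ} (hl : 1 < l) (hgap : ∀ t, M.s t = 1 ∨ l ≤ M.s t)
    {ρ : ι → ℝ} {b : ℤ → ι} (hb : ∀ k, M.Arrow (b k) (b (k + 1))) {d : ℤ → ℝ} (hd0 : ∀ k, 0 ≤ d k)
    (hdρ : ∀ k, d k ≤ ρ (b k)) (hd : ∀ k, d (k + 1) = d k / M.s (b k)) {u : ι}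
    (hu : ∃ᶠ n : ℕ in atTop, b (-n) = u) : d 0 = 0 := by
  have hprod : ∀ (k : ℤ) (n : ℕ), d (k + n) * ∏ i ∈ Finset.range n, M.s (b (k + i)) = d k := by
    intro k n
    induction n with
    | zero => simp
    | succ n ih =>
      rw [Finset.prod_range_succ]
      have h1 := hd (k + n)
      have h2 := (M.s_pos (b (k + n))).ne'
      push_cast
      rw [← add_assoc, h1, ← ih]
      field_simp
  have hone := fun (k : ℤ) (n : ℕ) =>
    le_prod_range (f := fun i : ℕ => M.s (b (k + i))) (fun i => M.one_le_s _) n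
  rw [frequently_atTop] at hu
  -- Each further return to `u` in the past completes a loop and gains a factor of at least `l`,
  -- while the difference there stays below `ρ u`.
  have hpow : ∀ (i : ℕ) (k : ℤ), b k = u → d k * l ^ i ≤ ρ u := by
    intro i
    induction i with
    | zero => intro k hk; simpa [hk] using hdρ k
    | succ i ih =>
      intro k hk
      -- Taking `m > |k|` puts the visit strictly before `k`, so the loop has positive length.
      obtain ⟨m, hm, hmu⟩ := hu (k.natAbs + 1)
      obtain ⟨n, hn⟩ : ∃ n : ℕ, k = -(m : ℤ) + n := ⟨(k + m).toNat, by omega⟩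
      have hn0 : 0 < n := by omega
      obtain ⟨j, hj, hs⟩ := M.exists_s_ne_one hG hsep hatom hn0 (fun i : ℕ => b (-(m : ℤ) + i))
        (fun i _ => by have := hb (-(m : ℤ) + i); push_cast; rwa [← add_assoc])
        (by simp only [← hn, hk, Nat.cast_zero, add_zero, hmu])
      have h1 : l ≤ ∏ i ∈ Finset.range n, M.s (b (-(m : ℤ) + i)) :=
        ((hgap _).resolve_left hs).trans ((hone (-(m : ℤ)) n).2 j hj)
      have h2 := hprod (-(m : ℤ)) n
      rw [← hn] at h2
      calc d k * l ^ (i + 1) = d k * l * l ^ i := by ring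
        _ ≤ d (-(m : ℤ)) * l ^ i := by
            rw [← h2]
            have := hd0 k
            gcongr
        _ ≤ ρ u := ih _ hmu
  obtain ⟨m, -, hm⟩ := hu 0
  have h0 : d (-(m : ℤ)) = 0 := by
    by_contra hne
    have hpos := (hd0 (-(m : ℤ))).lt_of_ne' hne
    obtain ⟨i, hi⟩ := pow_unbounded_of_one_lt (ρ u / d (-(m : ℤ))) hl
    rw [div_lt_iff₀ hpos] at hi
    have := hpow i _ hm
    linarith
  have h1 := hprod (-(m : ℤ)) m
  rw [neg_add_cancel, h0, mul_eq_zero] at h1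
  exact h1.resolve_right (zero_lt_one.trans_le (hone (-(m : ℤ)) m).1).ne'

variable [LinearOrder ι] [WellFoundedLT ι]

lemma skew_iterate_fst (ρ : ι → ℝ) (z : (E × ι) × ℝ) (n : ℕ) :
    ((M.skew ρ)^[n] z).1 = M.step^[n] z.1 := by
  induction n with
  | zero => rfl
  | succ n ih => rw [Function.iterate_succ_apply', Function.iterate_succ_apply', ← ih]; rfl

/-- The rugs, coded by the levels visited: on an invariant core that consists of recurrent points
the code determines the point. -/
theorem injective_code {F : (E × ι) × ℝ → (E × ι) × ℝ} {Y C : Set ((E × ι) × ℝ)}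
    {ν : Measure ((E × ι) × ℝ)} (hC : IsInvariantCore F Y ν C) {ρ : ι → ℝ} (hCY : C ⊆ M.goodRugs ρ)
    (heq : EqOn F (M.skew ρ) C) {G : Set E} (hG : M.μ Gᶜ = 0) (hsep : M.Separates G)
    (hCG : ∀ z ∈ C, z.1.1 ∈ G) (hatom : ∀ x, M.μ {x} = 0) {l : ℝ} (hl : 1 < l)
    (hgap : ∀ t, M.s t = 1 ∨ l ≤ M.s t)
    (hrec : ∀ o, IsOrbitIn F Y o → o 0 ∈ C → ∃ u, ∃ᶠ n : ℕ in atTop, (o (-n)).1.2 = u) :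
    Function.Injective (hC.code fun z => z.1.2) := by
  intro z z' h
  have hcode : ∀ k, (hC.orbit z k : (E × ι) × ℝ).1.2 = (hC.orbit z' k : (E × ι) × ℝ).1.2 :=
    fun k => congrFun h k
  have hstep : ∀ (z : C) k, (hC.orbit z (k + 1) : (E × ι) × ℝ) = M.skew ρ (hC.orbit z k) :=
    fun z k =>
      (hC.isOrbitIn_orbit z k).2.symm.trans (heq (Subtype.coe_prop _))
  have hgood : ∀ (z : C) k, (hC.orbit z k : (E × ι) × ℝ) ∈ M.goodRugs ρ := fun z k =>
    hCY (Subtype.coe_prop _)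
  have harrow : ∀ (z : C) k, M.Arrow (hC.orbit z k : (E × ι) × ℝ).1.2
      (hC.orbit z (k + 1) : (E × ι) × ℝ).1.2 := by
    intro z k
    obtain ⟨-, v, hv, hT⟩ := hgood z k
    have : (hC.orbit z (k + 1) : (E × ι) × ℝ).1.2 = v := by
      rw [hstep]; exact M.next_eq hv hT
    rwa [this]
  have hiter : ∀ (z : C) (n : ℕ), (hC.orbit z n : (E × ι) × ℝ).1.1 = M.T^[n] z.1.1.1 := by
    intro z n
    induction n with
    | zero => simp [hC.orbit_zero]
    | succ n ih =>
      rw [Function.iterate_succ_apply', ← ih]; push_cast; rw [hstep]; rfl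
  -- The nonnegative half of the code fixes the base point.
  have hx : z.1.1.1 = z'.1.1.1 := by
    refine hsep _ (hCG _ z.2) _ (hCG _ z'.2) (fun n => (hC.orbit z n : (E × ι) × ℝ).1.2)
      fun n => ⟨?_, ?_⟩
    · rw [← hiter]; exact (hgood z n).1.1
    · rw [← hiter, hcode]; exact (hgood z' n).1.1
  have ht : z.1.1.2 = z'.1.1.2 := by simpa [hC.orbit_zero] using hcode 0
  obtain ⟨u, hu⟩ := hrec _ (hC.isOrbitIn_orbit z) (by simp [hC.orbit_zero])
  have hy := M.eq_zero_of_contracted hG hsep hatom hl hgap (ρ := ρ)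
    (b := fun k => (hC.orbit z k : (E × ι) × ℝ).1.2) (harrow z)
    (d := fun k => |(hC.orbit z k : (E × ι) × ℝ).2 - (hC.orbit z' k : (E × ι) × ℝ).2|)
    (fun k => abs_nonneg _) (fun k => ?_) (fun k => ?_) hu
  · have hy' : z.1.2 = z'.1.2 := by simpa [hC.orbit_zero, sub_eq_zero] using hy
    exact Subtype.ext (Prod.ext (Prod.ext hx ht) hy')
  · have h1 := (hgood z k).1.2
    have h2 := (hgood z' k).1.2
    rw [← hcode] at h2
    rw [abs_le]
    constructor <;> linarith [h1.1, h1.2, h2.1, h2.2]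
  -- Equal codes give equal source and target levels, hence equal offsets, which cancel in the
  -- difference.
  · have h1 : M.next (hC.orbit z k : (E × ι) × ℝ).1 = M.next (hC.orbit z' k : (E × ι) × ℝ).1 := by
      have := hcode (k + 1)
      rwa [hstep, hstep] at this
    simp only [hstep, skew]
    rw [← h1, ← hcode, add_sub_add_right_eq_sub, ← sub_div, abs_div,
      abs_of_pos (M.s_pos _)]

end MarkovTower

/-! ### Identification of the natural extension with the skew product. -/

namespace PWSystem.Tower

variable {E : Type*} [TopologicalSpace E] [PolishSpace E] [MeasurableSpace E] [BorelSpace E]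
  {S : PWSystem E} (τ : Tower S) (hS : S.Conditions)

lemma trans_eq (t u : τ.α) : τ.trans t u = (τ.markovTower hS).prob t u := by
  set M := τ.markovTower hS with hM
  have h1 : (τ.level t ∩ τ.That ⁻¹' τ.level u : Set (E × τ.α)) =ᵐ[M.weight 1]
      M.itinerary 1 (fun i => if i = 0 then t else u) := by
    have hae : ∀ᵐ p ∂(M.weight 1), p.1 ∈ M.D p.2 ∧ ∃ v, M.Arrow p.2 v ∧ M.T p.1 ∈ M.D v := by
      refine M.ae_weight 1 fun u => ?_
      filter_upwards [M.exhaust u, ae_restrict_mem (M.measurableSet_D u)] with x h1 h2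
      exact ⟨h2, h1⟩
    filter_upwards [hae] with ⟨x, t'⟩ ⟨hx, v, hv, hT⟩
    have hstep : τ.That (x, t') = M.step (x, t') := τ.That_eq_step hS hx hv hT
    have hnext : M.step (x, t') = (M.T x, v) := by rw [MarkovTower.step, M.next_eq hv hT]
    refine propext ?_
    change ((x, t') ∈ τ.level t ∧ τ.That (x, t') ∈ τ.level u) ↔
      (x, t') ∈ M.itinerary (0 + 1) (fun i => if i = 0 then t else u)
    rw [M.itinerary_succ, hstep, hnext]
    have h2 : (M.T x, v) ∈ M.itinerary 0 (fun i => if i + 1 = 0 then t else u) ↔ v = u := by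
      simp [MarkovTower.itinerary]
    rw [h2]
    constructor
    · rintro ⟨h3, h4⟩; exact ⟨h3.1, h4.1⟩
    · rintro ⟨h3, h4⟩
      exact ⟨⟨h3, by cases h3; exact τ.coreLevel_subset hS _ hx⟩, h4, by
        cases h4; exact τ.coreLevel_subset hS _ hT⟩
  rw [trans, τ.mubar_eq hS, measure_congr h1, MarkovTower.weight_itinerary, τ.weight_level hS]
  simp only [Pi.one_apply, one_mul, Finset.prod_range_one]
  simp only [if_true, zero_add, one_ne_zero, if_false]
  rw [mul_comm]
  exact ENNReal.mul_div_cancel_right (M.pos t).ne' (measure_ne_top _ _)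

lemma finite_Iio (u : τ.α) : (Iio u).Finite :=
  ((Set.finite_Iio (u : ℕ)).preimage Subtype.val_injective.injOn).subset fun _ h => h

/-- Each level lies in exactly one piece, so the sum over `k` merely selects the Jacobian `s (last
t)`. Only the finitely many `t < u` contribute, so the sums may be exchanged. -/
lemma offset_eq (μhat : Measure (E × τ.α)) (u v : τ.α) : τ.offset μhat u v =
    precedingSum ((τ.markovTower hS).height (τ.rho μhat) v) u := by
  classical
  have hk : ∀ (k : Fin S.N) (t : τ.α),
      (if t < u ∧ τ.D t ⊆ S.Z k ∧ τ.Arrow t v then τ.rho μhat t / S.s k else 0) =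
      if k = τ.last t then
        (if t < u then (τ.markovTower hS).height (τ.rho μhat) v t else 0) else 0 := by
    intro k t
    rw [τ.D_subset_iff hS]
    by_cases h1 : k = τ.last t
    · subst h1
      by_cases h2 : t < u
      · simp only [h2, true_and, if_true]; rfl
      · simp [h2]
    · simp [h1]
  rw [offset, precedingSum]
  simp_rw [hk]
  rw [← Summable.tsum_finsetSum]
  · refine tsum_congr fun t => ?_
    simp
  · intro k _
    refine summable_of_hasFiniteSupport ((τ.finite_Iio u).subset fun t ht => ?_)
    by_contra h
    have : ¬ t < u := h
    simp [this] at ht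

lemma F_eq_skew (μhat : Measure (E × τ.α)) :
    EqOn (τ.F μhat) ((τ.markovTower hS).skew (τ.rho μhat))
      ((τ.markovTower hS).goodRugs (τ.rho μhat)) := by
  rintro ⟨⟨x, t⟩, y⟩ ⟨hz, v, hv, hT⟩
  have hstep : τ.That (x, t) = (τ.markovTower hS).step (x, t) :=
    τ.That_eq_step hS hz.1 hv hT
  simp only [F, MarkovTower.skew, hstep, τ.offset_eq hS]
  rfl

lemma goodRugs_subset_Y (μhat : Measure (E × τ.α)) :
    (τ.markovTower hS).goodRugs (τ.rho μhat) ⊆ τ.Y μhat := by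
  rintro ⟨⟨x, t⟩, y⟩ ⟨hz, -⟩
  exact mem_iUnion.2 ⟨t, ⟨rfl, τ.coreLevel_subset hS t hz.1⟩, hz.2.1, hz.2.2.le⟩

lemma mem_Y {μhat : Measure (E × τ.α)} {z : (E × τ.α) × ℝ} :
    z ∈ τ.Y μhat ↔ z.1.1 ∈ τ.D z.1.2 ∧ z.2 ∈ Icc 0 (τ.rho μhat z.1.2) := by
  rw [Y, mem_iUnion]
  constructor
  · rintro ⟨u, ⟨rfl, h1⟩, h2⟩; exact ⟨h1, h2⟩
  · rintro ⟨h1, h2⟩; exact ⟨_, ⟨rfl, h1⟩, h2⟩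

/-- Closed and half-open rugs differ by the graph of `ρ`, whose vertical sections are points, and
the levels differ from their Borel versions by null sets. -/
lemma nu_eq (μhat : Measure (E × τ.α)) :
    τ.nu μhat = (τ.markovTower hS).rugMeasure (τ.rho μhat) := by
  set M := τ.markovTower hS with hM
  rw [nu, MarkovTower.rugMeasure, τ.mubar_eq hS]
  refine Measure.restrict_congr_set ?_
  have h1 : ∀ᵐ z ∂((M.weight 1).prod (volume : Measure ℝ)), z.1.1 ∈ M.D z.1.2 :=
    Measure.quasiMeasurePreserving_fst.ae (p := fun q : E × τ.α => q.1 ∈ M.D q.2)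
      (M.ae_weight 1 fun u => ae_restrict_mem (M.measurableSet_D u))
  have h2 : ∀ᵐ z ∂((M.weight 1).prod (volume : Measure ℝ)), z.2 ≠ τ.rho μhat z.1.2 := by
    have hm : MeasurableSet {z : (E × τ.α) × ℝ | z.2 = τ.rho μhat z.1.2} :=
      measurableSet_eq_fun measurable_snd ((Measurable.of_discrete (f := τ.rho μhat)).comp
        (measurable_snd.comp measurable_fst))
    have h3 : ((M.weight 1).prod (volume : Measure ℝ)) {z | z.2 = τ.rho μhat z.1.2} = 0 := by
      rw [Measure.measure_prod_null hm]
      refine Eventually.of_forall fun p => ?_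
      have : Prod.mk p ⁻¹' {z : (E × τ.α) × ℝ | z.2 = τ.rho μhat z.1.2} = {τ.rho μhat p.2} := by
        ext y; simp
      simp only [this, Real.volume_singleton, Pi.zero_apply]
    exact measure_eq_zero_iff_ae_notMem.1 h3
  filter_upwards [h1, h2] with z hz1 hz2
  refine propext ((τ.mem_Y).trans ⟨fun h => ⟨hz1, h.2.1, h.2.2.lt_of_ne hz2⟩, fun h =>
    ⟨τ.coreLevel_subset hS _ h.1, h.2.1, h.2.2.le⟩⟩)

lemma That_eq_or (p : E × τ.α) : (τ.That p).1 = S.T p.1 ∨ τ.That p = p := by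
  by_cases h : ∃ v, τ.Arrow p.2 v ∧ S.T p.1 ∈ τ.D v
  · left; rw [That, dif_pos h]
  · right; rw [That, dif_neg h]

lemma measure_image_exceptional (μhat : Measure (E × τ.α)) :
    (τ.markovTower hS).rugMeasure (τ.rho μhat)
      (τ.F μhat '' (τ.Y μhat \ (τ.markovTower hS).goodRugs (τ.rho μhat))) = 0 := by
  set M := τ.markovTower hS with hM
  let good : τ.α → Set E := fun t => {x | x ∈ M.D t ∧ ∃ v, M.Arrow t v ∧ M.T x ∈ M.D v}
  have hbad : ∀ t, S.μ (τ.D t \ good t) = 0 := by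
    intro t
    have h1 := (ae_restrict_iff' (M.measurableSet_D t)).1 (M.exhaust t)
    have h2 : ∀ᵐ x ∂S.μ, x ∉ τ.D t \ good t := by
      filter_upwards [h1, τ.coreLevel_ae_eq hS t] with x hx1 hx2 hx
      have hx3 : x ∈ M.D t := (iff_of_eq hx2).2 hx.1
      exact hx.2 ⟨hx3, hx1 hx3⟩
    exact measure_eq_zero_iff_ae_notMem.2 h2
  -- Bad base points together with their images under `T`; the former are included because `That`
  -- may be the identity there.
  let N : Set E := ⋃ t, (τ.D t \ good t) ∪ S.T '' (τ.D t \ good t)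
  have hN : M.μ N = 0 := measure_iUnion_null fun t => measure_union_null (hbad t)
    (hS.measure_image_null (sdiff_subset.trans (τ.D_subset t)) (hbad t))
  -- The heights to which the top edges `y = ρ t` are sent. There are countably many, so they form a
  -- Lebesgue null set.
  let K : Set ℝ := range fun q : τ.α × τ.α =>
    τ.rho μhat q.1 / S.s (τ.last q.1) + τ.offset μhat q.1 q.2
  have hK : volume K = 0 := (countable_range _).measure_zero _
  have h1 : ∀ᵐ z ∂(M.rugMeasure (τ.rho μhat)), z.1.1 ∉ N := by
    refine ae_restrict_of_ae (Measure.quasiMeasurePreserving_fst.ae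
      (p := fun q : E × τ.α => q.1 ∉ N) (M.ae_weight 1 fun u => ?_))
    exact ae_restrict_of_ae (measure_eq_zero_iff_ae_notMem.1 hN)
  have h2 : ∀ᵐ z ∂(M.rugMeasure (τ.rho μhat)), z.2 ∉ K :=
    ae_restrict_of_ae (Measure.quasiMeasurePreserving_snd.ae (measure_eq_zero_iff_ae_notMem.1 hK))
  refine measure_eq_zero_iff_ae_notMem.2 ?_
  filter_upwards [h1, h2] with z hz1 hz2
  rintro ⟨⟨⟨x, t⟩, y⟩, ⟨hY, hbad⟩, rfl⟩
  rw [τ.mem_Y] at hY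
  by_cases hx : x ∈ good t
  · have hy : y = τ.rho μhat t := by
      by_contra hne
      exact hbad ⟨⟨hx.1, hY.2.1, hY.2.2.lt_of_ne hne⟩, hx.2⟩
    exact hz2 ⟨(t, (τ.That (x, t)).2), by rw [hy]; rfl⟩
  · refine hz1 (mem_iUnion.2 ⟨t, ?_⟩)
    rcases τ.That_eq_or (x, t) with h | h
    · right; exact ⟨x, ⟨hY.1, hx⟩, h.symm⟩
    · left
      change (τ.That (x, t)).1 ∈ _
      rw [h]; exact ⟨hY.1, hx⟩

/-- Orbits through the core are unique, so the choice made in `psi` is immaterial. -/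
lemma psi_eq_code {μhat : Measure (E × τ.α)} {ν : Measure ((E × τ.α) × ℝ)}
    {C : Set ((E × τ.α) × ℝ)} (hC : IsInvariantCore (τ.F μhat) (τ.Y μhat) ν C) (z : C) :
    τ.psi μhat z = hC.code (fun z => z.1.2) z := by
  have h : ∃ o, τ.IsOrbit μhat o ∧ o 0 = z :=
    ⟨_, hC.isOrbitIn_orbit z, by simp [hC.orbit_zero]⟩
  rw [psi, dif_pos h]
  funext k
  rw [hC.eq_orbit h.choose_spec.1 h.choose_spec.2 k]
  rfl

end PWSystem.Tower

lemma PWSystem.exists_gap {E : Type*} [TopologicalSpace E] [MeasurableSpace E] {S : PWSystem E}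
    (hs : ∀ j, 1 ≤ S.s j) : ∃ l > 1, ∀ j, S.s j = 1 ∨ l ≤ S.s j := by
  have h : ∀ᶠ l in 𝓝[>] (1 : ℝ), ∀ j, S.s j = 1 ∨ l ≤ S.s j := by
    refine eventually_all.2 fun j => ?_
    rcases (hs j).eq_or_lt with h | h
    · exact Eventually.of_forall fun _ => Or.inl h.symm
    · filter_upwards [Ioo_mem_nhdsGT h] with l hl
      exact Or.inr hl.2.le
  obtain ⟨l, hl, hl1⟩ := (h.and self_mem_nhdsWithin).exists
  exact ⟨l, hl1, hl⟩

end

/-! ### The isomorphism theorem. -/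

theorem mainTheorem4 {E : Type*} [TopologicalSpace E] [PolishSpace E] [MeasurableSpace E]
    [BorelSpace E] (S : PWSystem E) (hS : S.Conditions) (hatom : ∀ x, S.μ {x} = 0)
    (τ : PWSystem.Tower S) (μhat : Measure (E × τ.α)) (hprob : IsProbabilityMeasure μhat)
    (hlift : τ.IsVagueLimit μhat) :
    -- `(Y, ν)` is a probability space, almost every point of which has exactly one two-sided orbit
    τ.nu μhat univ = 1 ∧
    (∀ᵐ z ∂(τ.nu μhat), ∃! o, τ.IsOrbit μhat o ∧ o 0 = z) ∧
    -- `v` is a stationary probability vector of the stochastic matrix `P`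
    ∑' u, τ.initVec μhat u = 1 ∧
    (∀ t, ∑' u, τ.trans t u = 1) ∧
    (∀ u, ∑' t, τ.initVec μhat t * τ.trans t u = τ.initVec μhat u) ∧
    -- the coding map is an isomorphism onto the Markov shift
    (∃! m, IsMarkovMeasure (τ.initVec μhat) τ.trans m) ∧
    ∀ m, IsMarkovMeasure (τ.initVec μhat) τ.trans m →
      IsIsomorphism (τ.Y μhat) (τ.nu μhat) (τ.F μhat)
        (τ.psi μhat '' τ.Y μhat) m zshift (τ.psi μhat) := by
  obtain ⟨r, hr0, hμ, hr⟩ := τ.exists_density hS hlift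
  set M := τ.markovTower hS with hM
  have hinit : ∀ u, τ.initVec μhat u = ENNReal.ofReal (r u) * M.μ (M.D u) := by
    intro u
    rw [PWSystem.Tower.initVec]
    conv_lhs => rw [hμ]
    exact τ.weight_level hS _ u
  have hrho : τ.rho μhat = r := by
    funext u
    have h1 := hinit u
    rw [PWSystem.Tower.initVec] at h1
    rw [PWSystem.Tower.rho, h1, τ.mubar_eq hS, τ.weight_level hS, Pi.one_apply, one_mul,
      ENNReal.mul_div_cancel_right (M.pos u).ne' (measure_ne_top _ _), ENNReal.toReal_ofReal (hr0 u)]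
  have hmass : ∑' u, ENNReal.ofReal (r u) * M.μ (M.D u) = 1 := by
    rw [← M.weight_univ, ← hμ, measure_univ]
  have hνuniv : τ.nu μhat univ = 1 := by
    rw [τ.nu_eq hS, MarkovTower.rugMeasure_univ, hrho, hmass]
  have hνprob : IsProbabilityMeasure (τ.nu μhat) := ⟨hνuniv⟩
  have hpres : MeasurePreserving (M.skew r) (τ.nu μhat) (τ.nu μhat) := by
    rw [τ.nu_eq hS, hrho]
    exact M.measurePreserving_skew hr0 τ.finite_Iio hr
  obtain ⟨G, hG, hsep⟩ := τ.exists_separates hS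
  have hQ : τ.nu μhat {z | z.1.1 ∉ G} = 0 := by
    rw [τ.nu_eq hS]
    have h1 : ∀ᵐ z ∂(M.rugMeasure (τ.rho μhat)), z.1.1 ∈ G := by
      refine ae_restrict_of_ae (Measure.quasiMeasurePreserving_fst.ae
        (p := fun q : E × τ.α => q.1 ∈ G) (M.ae_weight 1 fun u => ?_))
      exact ae_restrict_of_ae hG
    exact h1
  have heq : EqOn (τ.F μhat) (M.skew r) (M.goodRugs r) := by
    have := τ.F_eq_skew hS μhat
    rwa [hrho] at this
  obtain ⟨C₀, hC₀, hC₀Y, hC₀Q⟩ := exists_isInvariantCore (F := τ.F μhat) (Y := τ.Y μhat) hpres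
    (M.measurableSet_goodRugs r) (by have := τ.goodRugs_subset_Y hS μhat; rwa [hrho] at this)
    (by rw [τ.nu_eq hS, hrho]; exact M.rugMeasure_compl_goodRugs r) (M.injOn_skew hr0 hr) heq
    (by have := τ.measure_image_exceptional hS μhat
        rw [← τ.nu_eq hS, hrho] at this; exact this) hQ
  have hκ : Measurable fun z : (E × τ.α) × ℝ => z.1.2 := measurable_snd.comp measurable_fst
  -- The core is shrunk once more so that every orbit in it is recurrent in the past; this is what
  -- injectivity of the code consumes.
  obtain ⟨C, hCC₀, hC, hrec⟩ := hC₀.exists_recurrent hpres (heq.mono hC₀Y) hκ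
  have hCY := hCC₀.trans hC₀Y
  have hinj : Function.Injective (hC.code fun z => z.1.2) := by
    obtain ⟨l, hl, hgap⟩ := PWSystem.exists_gap (S := S) fun j => (hS.c4 j).1
    refine M.injective_code hC hCY (heq.mono hCY) hG hsep (fun z hz => ?_) hatom hl
      (fun t => hgap _) hrec
    by_contra h
    exact Set.disjoint_left.1 hC₀Q (hCC₀ hz) h
  have hmarkov : IsMarkovMeasure (τ.initVec μhat) τ.trans
      (((τ.nu μhat).comap Subtype.val).map (hC.code fun z => z.1.2)) := by
    refine hC.isMarkovMeasure_map_code hpres (heq.mono hCY) hκ fun n w => ?_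
    simp_rw [M.skew_iterate_fst]
    rw [τ.nu_eq hS, hrho, hinit]
    simp_rw [τ.trans_eq hS]
    exact M.rugMeasure_itinerary n w
  refine ⟨hνuniv, ?_, ?_, ?_, ?_, ⟨_, hmarkov, fun m hm => hm.unique hmarkov⟩, fun m hm => ?_⟩
  · have : ∀ᵐ z ∂(τ.nu μhat), z ∈ C := by rw [ae_iff]; exact hC.null
    filter_upwards [this] with z hz
    exact hC.existsUnique_orbit hz
  · simp_rw [hinit]; exact hmass
  · intro t; simp_rw [τ.trans_eq hS]; exact M.tsum_prob t
  · intro u; simp_rw [hinit, τ.trans_eq hS]; exact M.tsum_mul_prob hr u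
  · rw [hm.unique hmarkov]
    exact hC.isIsomorphism_code hpres (heq.mono hCY) hκ hinj (τ.psi_eq_code hC)
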